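/- \textbf{Setting.} Let $L$ be a finite set of offline vertices with weights $w_i>0$, and let online vertices $j=1,\dots,n$ arrive in this order; let $p_{ij}\in[0,1]$ be the success probability of the pair $(i,j)$, with $p_{ij}=0$ if $i$ and $j$ are not adjacent. The numbers $(p_{ij})_{i\in L}$ are revealed when $j$ arrives, and $j$ must then be assigned irrevocably to at most one $i\in L$. If $M_i$ is the set of online vertices assigned to $i$ in the assignment $M$, the reward of $M$ is $$c(M)=\sum_{i\in L} w_i\min\Bigl\{1,\sum_{j\in M_i}p_{ij}\Bigr\}.$$ Let $\mathrm{OPT}$ be the maximum of $c(M)$ over all assignments $M$. \textbf{Algorithm.} Put $W_i=w_i$, $w_{ij}=w_ip_{ij}$ and $g(y)=e^{y-1}/(1-1/e)$. The algorithm keeps random variables $Y_i$, $B_i$, initially $0$. When $j$ arrives, let $\mathcal E$ be the realized assignment of the earlier vertices, let $$m_i=\min\Bigl\{w_{ij},\max\bigl\{0,\,W_i-\textstyle\sum_{j':(i,j')\in\mathcal E}w_{ij'}\bigr\}\Bigr\},$$ let $(Y_i\mid\mathcal E)$ be the value of $Y_i$ at the arrival of $j$, and start with $x_{ij}=0$ for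 all $i$. If $(Y_i\mid\mathcal E)\ge 1$ for all $i\in L$, nothing happens and $j$ stays unassigned. Otherwise the $x_{ij}$ are increased continuously until $\sum_i x_{ij}=1$, where at each moment only vertices $i$ maximizing $$m_i\Bigl(1-\frac{(B_i\mid\mathcal E)}{W_i}\Bigr)$$ are increased. Meanwhile $Y_i=(Y_i\mid\mathcal E)+\frac{m_i}{W_i}X_{ij}$ and $dB_i=m_i\,g(Y_i)\,dx_{ij}$. Here $X_{ij}$ is the $0$-$1$ indicator of assigning $j$ to $i$; during the increase it can only switch from $0$ to $1$, and it equals $1$ with probability $x_{ij}$ (the current value). $(B_i\mid\mathcal E)$ is the conditional expectation, given $\mathcal E$, of the current value of $B_i$. At the end, $j$ is assigned to $i$ with probability $x_{ij}$ for every $i$ (to at most one $i$, and to none with probability $1-\sum_i x_{ij}$). \textbf{Statement.} The algorithm is $(1-1/e)$-competitive for online matching with stochastic rewards and vanishing probabilities: for every $\varepsilon>0$ there is $\delta>0$ such that on every instance with $\max_{i,j}p_{ij}\le\delta$ (for any $L$, $n$, $w$, $p$) the algorithm has a run, and each of its runs (that is, whatever choices the rule above leaves open in case of ties) outputs a random assignment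 $M$ with $$\mathbb E[c(M)]\ \ge\ \Bigl(1-\frac1e-\varepsilon\Bigr)\,\mathrm{OPT}.$$ -/

import Mathlib

open Finset

noncomputable section

namespace OnlineMatching

/-- An assignment of the online vertices `Fin n` (listed in order of arrival) to offline vertices:
each online vertex gets at most one offline vertex, `none` meaning that it stays unassigned. -/
abbrev Assignment (L : Type*) (n : ℕ) := Fin n → Option L

/-- The 0-1 variable `X_{ij}`: online vertex `j` is assigned to `i` in `E`. -/
def X {L : Type*} [DecidableEq L] {n : ℕ} (E : Assignment L n) (i : L) (j : Fin n) : ℝ :=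
  if E j = some i then 1 else 0

/-- Online weighted matching with additive budgets: edge weights `w_{ij}` (zero on non-edges) and
budgets `W_i`. -/
structure BudgetInstance (L : Type*) (n : ℕ) where
  weight : L → Fin n → ℝ
  budget : L → ℝ
  weight_nonneg : ∀ i j, 0 ≤ weight i j
  budget_pos : ∀ i, 0 < budget i

/-- Online matching with stochastic rewards: weights `w_i` of the offline vertices and success
probabilities `p_{ij}` (zero on non-edges). -/
structure StochasticInstance (L : Type*) (n : ℕ) where
  weight : L → ℝ
  prob : L → Fin n → ℝ
  weight_pos : ∀ i, 0 < weight i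
  prob_nonneg : ∀ i j, 0 ≤ prob i j
  prob_le_one : ∀ i j, prob i j ≤ 1

namespace StochasticInstance

variable {L : Type*} [Fintype L] [DecidableEq L] {n : ℕ}

/-- The reward `c(M) = ∑_i w_i min {1, ∑_{j ∈ M_i} p_{ij}}`. -/
def reward (I : StochasticInstance L n) (M : Assignment L n) : ℝ :=
  ∑ i, I.weight i * min 1 (∑ j with M j = some i, I.prob i j)

/-- The offline optimum: the largest reward of an assignment. -/
def opt (I : StochasticInstance L n) : ℝ :=
  (univ : Finset (Assignment L n)).sup' univ_nonempty I.reward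

end StochasticInstance

/-- A stochastic-reward instance as an additive-budget instance: `w_i min {1, ∑ p_{ij}}` is
`min {w_i, ∑ w_i p_{ij}}`, so the edge weights are `w_i p_{ij}` and the budgets `w_i`. -/
def StochasticInstance.toBudget {L : Type*} {n : ℕ} (I : StochasticInstance L n) :
    BudgetInstance L n where
  weight i j := I.weight i * I.prob i j
  budget := I.weight
  weight_nonneg i j := mul_nonneg (I.weight_pos i).le (I.prob_nonneg i j)
  budget_pos := I.weight_pos

/-- `g(y) = e^{y-1} / (1 - 1/e)`. -/
def g (y : ℝ) : ℝ := Real.exp (y - 1) / (1 - 1 / Real.exp 1)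

/-! ### The primal-dual algorithm for additive budgets

Below, `E` is a realization of the random assignment. Every quantity attached to the arrival of `j`
reads only the entries of `E` before `j`. A family `x` of fractions records, as `x j E i`, the final
value of `x_{ij}` (the probability of assigning `j` to `i`) when the earlier vertices were assigned
as in `E`. The variables `A_j` of the algorithm are never read by it, so they are not modelled. -/

namespace BudgetInstance

variable {L : Type*} [DecidableEq L] {n : ℕ}

/-- The total weight `∑_{j' : (i,j') ∈ E} w_{ij'}` assigned to `i` before `j` arrives. -/
def load (I : BudgetInstance L n) (E : Assignment L n) (j : Fin n) (i : L) : ℝ :=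
  ∑ k ∈ Iio j, I.weight i k * X E i k

/-- `min {w_{ij}, max {0, W_i - ∑_{j' : (i,j') ∈ E} w_{ij'}}}`. -/
def gain (I : BudgetInstance L n) (E : Assignment L n) (j : Fin n) (i : L) : ℝ :=
  min (I.weight i j) (max 0 (I.budget i - I.load E j i))

/-- `(Y_i | E)` at the arrival of `j`: starting from `0`, each earlier `k` has added
`gain / W_i * X_{ik}`. -/
def Y (I : BudgetInstance L n) (E : Assignment L n) (j : Fin n) (i : L) : ℝ :=
  ∑ k ∈ Iio j, I.gain E k i / I.budget i * X E i k

/-- The expected increase of `B_i` while `x_{ij}` grows from `0` to `x` under the rule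
`dB_i = gain * g(Y_i) dx_{ij}`, where `Y_i = (Y_i | E) + gain / W_i * X_{ij}`, if `X_{ij} = 1` has
(conditional) probability `r * s` at the moment when `x_{ij} = s`. -/
def increaseB (I : BudgetInstance L n) (E : Assignment L n) (j : Fin n) (i : L) (r x : ℝ) : ℝ :=
  ∫ s in (0 : ℝ)..x, I.gain E j i *
    ((1 - r * s) * g (I.Y E j i) + r * s * g (I.Y E j i + I.gain E j i / I.budget i))

/-- `(B_i | E)` at the arrival of `j`, the conditional expectation of `B_i` given the realized
assignment of the earlier vertices. While `x_{ik}` grows, `X_{ik}` is a 0-1 variable that can only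
switch from `0` to `1` and has probability `s` of being `1` when `x_{ik} = s`; hence, given its
final value `X_{ik}` and the final value `x` of `x_{ik}`, it is `1` at that moment with conditional
probability `X_{ik} * s / x`. -/
def B (I : BudgetInstance L n) (x : Fin n → Assignment L n → L → ℝ) (E : Assignment L n)
    (j : Fin n) (i : L) : ℝ :=
  ∑ k ∈ Iio j, I.increaseB E k i (X E i k / x k E i) (x k E i)

/-- The quantity `gain * (1 - (B_i | E) / W_i)` maximized by the algorithm, at a moment of the
while loop for `j` when the current fractions `(x_{ij})_i` are `ξ`. At this moment `X_{ij}` is not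
yet realized, and is `1` with probability `ξ i`. -/
def score (I : BudgetInstance L n) (x : Fin n → Assignment L n → L → ℝ) (E : Assignment L n)
    (j : Fin n) (ξ : L → ℝ) (i : L) : ℝ :=
  I.gain E j i * (1 - (I.B x E j i + I.increaseB E j i 1 (ξ i)) / I.budget i)

/-- `ξ t`, for `0 ≤ t ≤ 1`, is an evolution of the fractions `(x_{ij})_i` in the while loop for `j`,
parametrized by their sum: the fractions start at `0`, grow continuously until their sum is `1`, and
`x_{ij}` grows only at moments when `i` is in the arg max of the current scores. (Ties need no
further rule: a score with positive gain strictly decreases when its fraction grows, so that tied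
vertices with positive gain have to grow together; vertices with zero gain keep score `0`.) -/
structure IsLoop [Fintype L] (I : BudgetInstance L n) (x : Fin n → Assignment L n → L → ℝ)
    (E : Assignment L n) (j : Fin n) (ξ : ℝ → L → ℝ) : Prop where
  start : ∀ i, ξ 0 i = 0
  mono : ∀ i, MonotoneOn (fun t => ξ t i) (Set.Icc 0 1)
  total : ∀ t ∈ Set.Icc (0 : ℝ) 1, ∑ i, ξ t i = t
  greedy : ∀ i, ∀ s ∈ Set.Icc (0 : ℝ) 1, ∀ t ∈ Set.Icc (0 : ℝ) 1, s < t → ξ s i < ξ t i →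
    ∃ u ∈ Set.Icc s t, ∀ k, I.score x E j (ξ u) k ≤ I.score x E j (ξ u) i

/-- `x` is a run of the algorithm: the fractions for `j` depend only on the realized assignment of
the earlier vertices; they stay `0` if `(Y_i | E) ≥ 1` for all `i`, and otherwise they result from
the while loop. -/
structure IsRun [Fintype L] (I : BudgetInstance L n) (x : Fin n → Assignment L n → L → ℝ) :
    Prop where
  adapted : ∀ j E E', (∀ k < j, E k = E' k) → x j E = x j E'
  idle : ∀ j E, (∀ i, 1 ≤ I.Y E j i) → ∀ i, x j E i = 0
  loop : ∀ j E, (∃ i, I.Y E j i < 1) → ∃ ξ : ℝ → L → ℝ, I.IsLoop x E j ξ ∧ x j E = ξ 1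

end BudgetInstance

/-- The probability that the final assignment is `M`: given the assignment of the earlier vertices,
`j` is assigned to `i` with probability `x_{ij}`, and to no vertex with the remaining probability. -/
def law {L : Type*} [Fintype L] {n : ℕ} (x : Fin n → Assignment L n → L → ℝ)
    (M : Assignment L n) : ℝ :=
  ∏ j, (M j).elim (1 - ∑ i, x j M i) (fun i => x j M i)

/-- The expectation of `c(M)` for the random final assignment `M`. -/
def expectedReward {L : Type*} [Fintype L] {n : ℕ} (x : Fin n → Assignment L n → L → ℝ)
    (c : Assignment L n → ℝ) : ℝ :=
  ∑ M, law x M * c M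

end OnlineMatching

end

/-! The argument is primal-dual, with duals that are feasible in expectation. The dual variable of
an offline vertex $i$ is the expectation $\beta_i$ of the final $B_i/W_i$. That of an online vertex
$j$ is the expectation $A_j$ of the positive parts of its initial scores, weighted by its fractions.
Assigning $j$ to $i$ raises $g(Y_i)$ by a jump $J$, so $g(Y_i)-g(0)$ is the sum of the $X_{ij}J$,
while $B_i/W_i$ is the sum of the $x_{ij}J$ up to a factor $1\pm\delta$. The difference of the two
sums is a martingale with jumps $O(\delta)$, hence with second moment $O(\delta)$.

Feasibility (`IsRun.dual_feasible`): scores only fall during the loop, so every final score is at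
most the initial score of each vertex used, hence at most their weighted average. As $B_k$ never
decreases, expectations give $w_{kj}(1-\beta_k)\le A_j$ up to a small multiple of $w_{kj}$. If the
gain is truncated, then $Y_k\ge 1-\delta$, and $g(1)-g(0)=1$ forces $1-B_k/W_k$ to be small up to
noise.

Value (`expectedReward_dual_le`): because $g'=g$, the payments made through $i$ and the growth of
$B_i/W_i$ add up to about $g(1)\,Y_i$, where $g(1)=1/(1-1/e)$ and $W_iY_i$ is the reward of $i$. The
error must be proportional to $\mathbb E[Y_i]$, since $\sum_i W_i$ is not controlled by the reward;
this is what `expectedReward_sum_noise_sq_le` provides. Weak duality (`IsRun.competitive`)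
concludes. Runs exist by water filling. -/

noncomputable section

namespace OnlineMatching

/-! ### Expectations of functions of the random assignment -/

section Expectation

variable {L : Type*} {n : ℕ}

/-- The probability of the `j`-th choice `o`, given the assignment `M` of the earlier vertices. -/
def stepProb [Fintype L] (x : Fin n → Assignment L n → L → ℝ) (j : Fin n) (M : Assignment L n)
    (o : Option L) : ℝ :=
  o.elim (1 - ∑ i, x j M i) (fun i => x j M i)

theorem sum_stepProb [Fintype L] (x : Fin n → Assignment L n → L → ℝ) (j : Fin n)
    (M : Assignment L n) : ∑ o, stepProb x j M o = 1 := by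
  simp [stepProb, Fintype.sum_option]

/-- The fractions `x` for `j` only depend on the choices for the vertices before `j`. -/
def IsAdapted (x : Fin n → Assignment L n → L → ℝ) : Prop :=
  ∀ j, DependsOn (x j) {k | (k : ℕ) < j}

theorem update_eq_of_dependsOn {t : ℕ} {F : Assignment L n → ℝ}
    (hF : DependsOn F {k | (k : ℕ) < t}) {j : Fin n} (hj : t ≤ j) (M : Assignment L n)
    (o : Option L) : F (Function.update M j o) = F M := by
  refine hF fun k hk => Function.update_of_ne ?_ _ _
  rintro rfl
  have : (k : ℕ) < t := hk
  omega

variable [Fintype L]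

theorem dependsOn_stepProb {x : Fin n → Assignment L n → L → ℝ} (hx : IsAdapted x) (j : Fin n) :
    DependsOn (stepProb x j) {k | (k : ℕ) < j} := by
  intro M M' h
  funext o
  simp only [stepProb, hx j h]

/-- Exchanging the new `j`-th value with the old one is an involution on pairs of a function and a
value. -/
theorem sum_sum_update {ι κ : Type*} [Fintype ι] [DecidableEq ι] [Fintype κ] (j : ι)
    (Φ : (ι → κ) → ℝ) :
    ∑ M, ∑ o, Φ (Function.update M j o) = (∑ M, Φ M) * Fintype.card κ := by
  have hinv : Function.Involutive
      (fun p : (ι → κ) × κ => (Function.update p.1 j p.2, p.1 j)) := by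
    rintro ⟨M, o⟩
    simp
  have h := Equiv.sum_comp (hinv.toPerm) (fun p : (ι → κ) × κ => Φ p.1)
  rw [Fintype.sum_prod_type, Fintype.sum_prod_type] at h
  simp only [Function.Involutive.coe_toPerm] at h
  rw [h, Finset.sum_mul]
  exact Finset.sum_congr rfl fun M _ => by simp [mul_comm]

/-- The total of `F` against the law of the first `t` choices, with all later choices equally
weighted. -/
def prefixSum (x : Fin n → Assignment L n → L → ℝ) (t : ℕ) (F : Assignment L n → ℝ) : ℝ :=
  ∑ M, (∏ k ∈ univ.filter (fun k : Fin n => (k : ℕ) < t), stepProb x k M (M k)) * F M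

theorem filter_val_lt_succ (j : Fin n) :
    (univ.filter fun k : Fin n => (k : ℕ) < j + 1) =
      insert j (univ.filter fun k : Fin n => (k : ℕ) < j) := by
  ext k
  simp only [mem_filter, mem_univ, true_and, mem_insert, Fin.ext_iff]
  omega

/-- Sums out the `j`-th choice. The uniform weights on later choices are not normalized, so each
step costs a factor equal to the number of choices. -/
theorem prefixSum_succ {x : Fin n → Assignment L n → L → ℝ} (hx : IsAdapted x) (j : Fin n)
    (F : Assignment L n → ℝ) :
    prefixSum x (j + 1) F * Fintype.card (Option L) =
      prefixSum x j (fun M => ∑ o, stepProb x j M o * F (Function.update M j o)) := by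
  unfold prefixSum
  rw [← sum_sum_update j]
  refine Finset.sum_congr rfl fun M _ => ?_
  rw [Finset.mul_sum]
  refine Finset.sum_congr rfl fun o _ => ?_
  rw [filter_val_lt_succ, Finset.prod_insert (by simp)]
  have hagree : ∀ k : Fin n, (k : ℕ) ≤ j → ∀ l ∈ {l : Fin n | (l : ℕ) < k},
      Function.update M j o l = M l := by
    intro k hk l hl
    rw [Function.update_of_ne]
    rintro rfl
    have : (l : ℕ) < k := hl
    omega
  have h1 : ∀ k ∈ univ.filter (fun k : Fin n => (k : ℕ) < j),
      stepProb x k (Function.update M j o) (Function.update M j o k) = stepProb x k M (M k) := by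
    intro k hk
    have hk' : (k : ℕ) < j := (Finset.mem_filter.1 hk).2
    rw [dependsOn_stepProb hx k (hagree k hk'.le), hagree j le_rfl k hk']
  rw [Finset.prod_congr rfl h1, dependsOn_stepProb hx j (hagree j le_rfl), Function.update_self]
  ring

theorem prefixSum_of_dependsOn {x : Fin n → Assignment L n → L → ℝ} (hx : IsAdapted x) {t : ℕ}
    {F : Assignment L n → ℝ} (hF : DependsOn F {k | (k : ℕ) < t}) (s : ℕ) (hs : t + s ≤ n) :
    prefixSum x (t + s) F * (Fintype.card (Option L) : ℝ) ^ s = prefixSum x t F := by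
  induction s with
  | zero => simp
  | succ s ih =>
    rw [← ih (by omega), pow_succ', ← mul_assoc]
    congr 1
    rw [← add_assoc, prefixSum_succ hx ⟨t + s, by omega⟩]
    unfold prefixSum
    refine Finset.sum_congr rfl fun M _ => ?_
    congr 1
    calc _ = ∑ o, stepProb x ⟨t + s, by omega⟩ M o * F M :=
          Finset.sum_congr rfl fun o _ => by rw [update_eq_of_dependsOn hF (by simp)]
      _ = F M := by rw [← Finset.sum_mul, sum_stepProb, one_mul]

theorem expectedReward_eq_prefixSum (x : Fin n → Assignment L n → L → ℝ)
    (F : Assignment L n → ℝ) : expectedReward x F = prefixSum x n F := by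
  unfold expectedReward prefixSum law
  refine Finset.sum_congr rfl fun M _ => ?_
  rw [Finset.filter_true_of_mem fun k _ => k.2]
  rfl

/-- The tower property: given the past, `X M i j` has mean `x j M i`. All martingale computations
below rest on it. -/
theorem expectedReward_mul_X [DecidableEq L] {x : Fin n → Assignment L n → L → ℝ}
    (hx : IsAdapted x) (i : L) (j : Fin n) {F : Assignment L n → ℝ}
    (hF : DependsOn F {k | (k : ℕ) < j}) :
    expectedReward x (fun M => F M * X M i j) = expectedReward x (fun M => F M * x j M i) := by
  have hj := j.2
  have hO : (0 : ℝ) < Fintype.card (Option L) := by exact_mod_cast Fintype.card_pos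
  obtain ⟨s, hs⟩ : ∃ s, n = j + 1 + s := ⟨n - (j + 1), by omega⟩
  have hH : DependsOn (fun M => F M * X M i j) {k | (k : ℕ) < j + 1} := by
    intro M M' h
    have h1 : F M = F M' := hF fun k hk => h k (Nat.lt_succ_of_lt hk)
    have h2 : M j = M' j := h j (Nat.lt_succ_self _)
    simp only [h1, X, h2]
  have hG : DependsOn (fun M => F M * x j M i) {k | (k : ℕ) < j} := by
    intro M M' h
    simp only [hF h, hx j h]
  have e1 := prefixSum_of_dependsOn hx hH s (by omega)
  have e2 := prefixSum_of_dependsOn hx hG (s + 1) (by omega)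
  have e3 := prefixSum_succ hx j (fun M => F M * X M i j)
  have e4 : (fun M => ∑ o, stepProb x j M o *
      (F (Function.update M j o) * X (Function.update M j o) i j)) = fun M => F M * x j M i := by
    funext M
    simp [update_eq_of_dependsOn hF le_rfl, X, stepProb, mul_comm]
  rw [e4] at e3
  rw [← e2, ← e1] at e3
  rw [expectedReward_eq_prefixSum, expectedReward_eq_prefixSum]
  have h1 : (j : ℕ) + (s + 1) = n := by omega
  have h2 : (j : ℕ) + 1 + s = n := by omega
  rw [h1, h2] at e3
  have : (0 : ℝ) < (Fintype.card (Option L) : ℝ) ^ (s + 1) := by positivity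
  rw [mul_assoc, ← pow_succ] at e3
  exact mul_right_cancel₀ this.ne' e3

theorem expectedReward_const {x : Fin n → Assignment L n → L → ℝ} (hx : IsAdapted x) (c : ℝ) :
    expectedReward x (fun _ => c) = c := by
  have hF : DependsOn (fun _ : Assignment L n => c) {k | (k : ℕ) < 0} := fun _ _ _ => rfl
  have h := prefixSum_of_dependsOn hx hF n (by omega)
  have hO : (0 : ℝ) < Fintype.card (Option L) := by exact_mod_cast Fintype.card_pos
  have hp : (0 : ℝ) < (Fintype.card (Option L) : ℝ) ^ n := by positivity
  rw [expectedReward_eq_prefixSum]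
  rw [zero_add] at h
  refine mul_right_cancel₀ hp.ne' (h.trans ?_)
  simp [prefixSum, mul_comm]

theorem expectedReward_add (x : Fin n → Assignment L n → L → ℝ) (F F' : Assignment L n → ℝ) :
    expectedReward x (fun M => F M + F' M) = expectedReward x F + expectedReward x F' := by
  simp only [expectedReward, mul_add, Finset.sum_add_distrib]

theorem expectedReward_sub (x : Fin n → Assignment L n → L → ℝ) (F F' : Assignment L n → ℝ) :
    expectedReward x (fun M => F M - F' M) = expectedReward x F - expectedReward x F' := by
  simp only [expectedReward, mul_sub, Finset.sum_sub_distrib]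

theorem expectedReward_mul_left (x : Fin n → Assignment L n → L → ℝ) (c : ℝ)
    (F : Assignment L n → ℝ) :
    expectedReward x (fun M => c * F M) = c * expectedReward x F := by
  simp only [expectedReward, Finset.mul_sum]
  exact Finset.sum_congr rfl fun M _ => by ring

theorem expectedReward_sum {ι : Type*} (s : Finset ι) (x : Fin n → Assignment L n → L → ℝ)
    (F : ι → Assignment L n → ℝ) :
    expectedReward x (fun M => ∑ i ∈ s, F i M) = ∑ i ∈ s, expectedReward x (F i) := by
  simp only [expectedReward, Finset.mul_sum]
  exact Finset.sum_comm

theorem law_nonneg {x : Fin n → Assignment L n → L → ℝ} (h0 : ∀ j M i, 0 ≤ x j M i)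
    (h1 : ∀ j M, ∑ i, x j M i ≤ 1) (M : Assignment L n) : 0 ≤ law x M := by
  refine Finset.prod_nonneg fun j _ => ?_
  cases M j with
  | none => simpa using h1 j M
  | some i => simpa using h0 j M i

theorem expectedReward_mono {x : Fin n → Assignment L n → L → ℝ} (h0 : ∀ j M i, 0 ≤ x j M i)
    (h1 : ∀ j M, ∑ i, x j M i ≤ 1) {F F' : Assignment L n → ℝ} (h : ∀ M, F M ≤ F' M) :
    expectedReward x F ≤ expectedReward x F' :=
  Finset.sum_le_sum fun M _ => mul_le_mul_of_nonneg_left (h M) (law_nonneg h0 h1 M)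

/-- Fractions that are probabilities and depend on the past only. -/
structure IsStrategy (x : Fin n → Assignment L n → L → ℝ) : Prop where
  adapted : IsAdapted x
  nonneg : ∀ j M i, 0 ≤ x j M i
  sum_le_one : ∀ j M, ∑ i, x j M i ≤ 1

theorem IsStrategy.le_one (hx : IsStrategy x) (j : Fin n) (M : Assignment L n) (i : L) :
    x j M i ≤ 1 :=
  (Finset.single_le_sum (f := x j M) (fun k _ => hx.nonneg j M k) (mem_univ i)).trans
    (hx.sum_le_one j M)

theorem IsStrategy.mono (hx : IsStrategy x) {F F' : Assignment L n → ℝ} (h : ∀ M, F M ≤ F' M) :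
    expectedReward x F ≤ expectedReward x F' :=
  expectedReward_mono hx.nonneg hx.sum_le_one h

end Expectation

end OnlineMatching

end

noncomputable section

namespace OnlineMatching

/-! ### Water filling -/

-- Here `h l` is the fraction at which a falling score reaches the level `l`, truncated at `0` when
-- the score starts below `l`.
open Filter in
theorem exists_inverse_of_strictAntiOn {f : ℝ → ℝ} (ha : StrictAntiOn f (Set.Ici 0))
    (hc : Continuous f) (hl : Tendsto f atTop atBot) :
    ∃ h : ℝ → ℝ, Continuous h ∧ Antitone h ∧ (∀ l, 0 ≤ h l) ∧ (∀ l, f (h l) ≤ l) ∧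
      (∀ l, 0 < h l → f (h l) = l) ∧ 1 ≤ h (f 1) ∧ h (f 0) = 0 := by
  -- Continuing `-f` with slope one to the negative axis gives an increasing bijection of the line,
  -- whose inverse is truncated afterwards.
  set F : ℝ → ℝ := fun s => -f (max s 0) + min s 0 with hF
  have hmono : StrictMono F := by
    intro s t hst
    simp only [hF]
    rcases le_or_gt 0 s with hs | hs
    · have ht : 0 ≤ t := hs.trans hst.le
      rw [max_eq_left hs, max_eq_left ht, min_eq_right hs, min_eq_right ht]
      linarith [ha hs ht hst]
    · rcases le_or_gt 0 t with ht | ht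
      · rw [max_eq_right hs.le, max_eq_left ht, min_eq_left hs.le, min_eq_right ht]
        have := ha.antitoneOn (Set.mem_Ici.2 le_rfl) ht ht
        linarith
      · rw [max_eq_right hs.le, max_eq_right ht.le, min_eq_left hs.le, min_eq_left ht.le]
        linarith
  have hcont : Continuous F := by fun_prop
  have htop : Tendsto F atTop atTop := by
    refine (tendsto_neg_atBot_atTop.comp hl).congr' ?_
    filter_upwards [eventually_ge_atTop (0 : ℝ)] with s hs
    simp [hF, max_eq_left hs, min_eq_right hs]
  have hbot : Tendsto F atBot atBot := by
    refine (tendsto_atBot_add_const_left atBot (-f 0) tendsto_id).congr' ?_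
    filter_upwards [eventually_le_atBot (0 : ℝ)] with s hs
    simp [hF, max_eq_right hs, min_eq_left hs]
  let e : ℝ ≃o ℝ := hmono.orderIsoOfSurjective F (hcont.surjective htop hbot)
  have he : ∀ s, e s = F s := fun s => rfl
  have hes : ∀ l, F (e.symm l) = l := fun l => by rw [← he, e.apply_symm_apply]
  have hF1 : e.symm (-f 1) = 1 := by
    rw [OrderIso.symm_apply_eq, he]; simp [hF]
  have hF0 : e.symm (-f 0) = 0 := by
    rw [OrderIso.symm_apply_eq, he]; simp [hF]
  refine ⟨fun l => max (e.symm (-l)) 0, ?_, ?_, fun l => le_max_right _ _, ?_, ?_, ?_, ?_⟩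
  · exact (e.symm.continuous.comp continuous_neg).max continuous_const
  · intro a b hab
    exact max_le_max (e.symm.monotone (neg_le_neg hab)) le_rfl
  · intro l
    have h := hes (-l)
    simp only [hF] at h
    linarith [min_le_right (e.symm (-l)) 0]
  · intro l hpos
    have h := hes (-l)
    have h0 : 0 < e.symm (-l) := by simpa using hpos
    simp only [hF] at h
    rw [min_eq_right h0.le] at h
    linarith
  · simp only [hF1]; exact le_max_left _ _
  · simp only [hF0, max_self]

-- Lower a common level continuously and give each vertex the fraction that brings its score down to
-- that level; the level is chosen so that the total is `t`. An identically zero score blocks the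
-- level at `0`, and a vertex with such a score then absorbs the remaining mass.
open Filter in
theorem exists_waterFilling {L : Type*} [Fintype L] [DecidableEq L] [Nonempty L]
    {f : L → ℝ → ℝ} (hf : ∀ i, f i = 0 ∨
      (StrictAntiOn (f i) (Set.Ici 0) ∧ Continuous (f i) ∧ Tendsto (f i) atTop atBot)) :
    ∃ ξ : ℝ → L → ℝ, (∀ i, ξ 0 i = 0) ∧
      (∀ i, MonotoneOn (fun t => ξ t i) (Set.Icc 0 1)) ∧
      (∀ t ∈ Set.Icc (0 : ℝ) 1, ∑ i, ξ t i = t) ∧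
      (∀ i, ∀ s ∈ Set.Icc (0 : ℝ) 1, ∀ t ∈ Set.Icc (0 : ℝ) 1, s < t → ξ s i < ξ t i →
        ∃ u ∈ Set.Icc s t, ∀ k, f k (ξ u k) ≤ f i (ξ u i)) := by
  have hinv : ∀ i, ∃ h : ℝ → ℝ, Continuous h ∧ Antitone h ∧ (∀ l, 0 ≤ h l) ∧
      (∀ l, (f i = 0 → 0 ≤ l) → f i (h l) ≤ l) ∧ (∀ l, 0 < h l → f i (h l) = l) ∧
      (f i ≠ 0 → 1 ≤ h (f i 1) ∧ f i 1 ≤ f i 0) ∧ h (f i 0) = 0 := by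
    intro i
    by_cases h0 : f i = 0
    · exact ⟨fun _ => 0, continuous_const, antitone_const, fun _ => le_rfl,
        fun l hl => by simpa [h0] using hl h0, fun l hl => absurd hl (lt_irrefl _),
        fun h => absurd h0 h, rfl⟩
    · obtain ⟨ha, hc, hl⟩ := (hf i).resolve_left h0
      obtain ⟨h, h1, h2, h3, h4, h5, h6, h7⟩ := exists_inverse_of_strictAntiOn ha hc hl
      exact ⟨h, h1, h2, h3, fun l _ => h4 l, h5, fun _ => ⟨h6, ha.antitoneOn
        (Set.mem_Ici.2 le_rfl) (Set.mem_Ici.2 zero_le_one) zero_le_one⟩, h7⟩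
  choose h hcont hanti hnn hle hpos hone hzero using hinv
  set H : ℝ → ℝ := fun l => ∑ i, h i l with hH
  have hHcont : Continuous H := continuous_finsetSum _ fun i _ => hcont i
  have hHnn : ∀ l, 0 ≤ H l := fun l => Finset.sum_nonneg fun i _ => hnn i l
  -- The level for a given total need not be unique, but the individual fractions are determined by
  -- the total and monotone in it.
  have hcmp : ∀ a b, H a ≤ H b → ∀ i, h i a ≤ h i b := by
    intro a b hab i
    rcases le_total b a with hba | hba
    · exact hanti i hba
    · have h1 : ∀ k ∈ (univ : Finset L), h k b ≤ h k a := fun k _ => hanti k hba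
      have h2 : H b = H a := le_antisymm (Finset.sum_le_sum h1) hab
      exact ((Finset.sum_eq_sum_iff_of_le h1).1 h2 i (mem_univ i)).ge
  set l1 : ℝ := ∑ i, |f i 0| with hl1
  have hl1le : ∀ i, f i 0 ≤ l1 := fun i => (le_abs_self _).trans
    (Finset.single_le_sum (f := fun i => |f i 0|) (fun k _ => abs_nonneg _) (mem_univ i))
  have hH1 : H l1 = 0 := Finset.sum_eq_zero fun i _ =>
    le_antisymm ((hanti i (hl1le i)).trans (hzero i).le) (hnn i l1)
  -- The lowest admissible level `l0` is `0` if some score vanishes identically; otherwise it is low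
  -- enough for a total of at least `1`.
  obtain ⟨z, l0, hl01, hl0, hz⟩ : ∃ z l0, l0 ≤ l1 ∧ (∀ i, f i = 0 → 0 ≤ l0) ∧
      ((f z = 0 ∧ l0 = 0) ∨ 1 ≤ H l0) := by
    by_cases hex : ∃ z, f z = 0
    · obtain ⟨z, hz⟩ := hex
      exact ⟨z, 0, Finset.sum_nonneg fun i _ => abs_nonneg _, fun _ _ => le_rfl, Or.inl ⟨hz, rfl⟩⟩
    · push Not at hex
      obtain ⟨z⟩ := ‹Nonempty L›
      refine ⟨z, f z 1, (hone z (hex z)).2.trans (hl1le z), fun i hi => absurd hi (hex i),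
        Or.inr ((hone z (hex z)).1.trans ?_)⟩
      exact Finset.single_le_sum (f := fun i => h i (f z 1)) (fun k _ => hnn k _) (mem_univ z)
  have hlev : ∀ t : ℝ, ∃ l, l0 ≤ l ∧ H l = max 0 (min t (H l0)) := by
    intro t
    have := intermediate_value_Icc' hl01 hHcont.continuousOn
      (show max 0 (min t (H l0)) ∈ Set.Icc (H l1) (H l0) by
        rw [hH1]; exact ⟨le_max_left _ _, max_le (hHnn _) (min_le_right _ _)⟩)
    obtain ⟨l, hl, hl'⟩ := this
    exact ⟨l, hl.1, hl'⟩
  choose lam hlam hHlam using hlev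
  refine ⟨fun t i => h i (lam t) + if i = z then max 0 (t - H l0) else 0, ?_, ?_, ?_, ?_⟩
  · intro i
    have h0 : H (lam 0) = 0 := by rw [hHlam, min_eq_left (hHnn _), max_self]
    have h1 : h i (lam 0) = 0 :=
      le_antisymm (((hcmp _ l1 (by rw [h0, hH1]) i)).trans
        ((hanti i (hl1le i)).trans (hzero i).le)) (hnn _ _)
    have h2 : max 0 (0 - H l0) = 0 := max_eq_left (by linarith [hHnn l0])
    dsimp only
    rw [h1, h2]
    simp
  · intro i s _ t _ hst
    have h1 : h i (lam s) ≤ h i (lam t) := by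
      refine hcmp _ _ ?_ i
      rw [hHlam, hHlam]
      gcongr
    dsimp only
    split_ifs
    · gcongr
    · gcongr
  · intro t ht
    simp only [Finset.sum_add_distrib, Finset.sum_ite_eq', mem_univ, if_true]
    have : ∑ i, h i (lam t) = H (lam t) := rfl
    rw [this, hHlam]
    have := hHnn l0
    rcases le_total t (H l0) with h' | h'
    · rw [min_eq_left h', max_eq_right ht.1, max_eq_left (by linarith)]; ring
    · rw [min_eq_right h', max_eq_right this, max_eq_right (by linarith)]; ring
  · intro i s _ t ht hst hlt
    -- The end of the interval works: a vertex that has received mass sits exactly at the level, and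
    -- every other score is at most the level.
    refine ⟨t, ⟨hst.le, le_rfl⟩, fun k => ?_⟩
    have hsnn : 0 ≤ h i (lam s) + if i = z then max 0 (s - H l0) else 0 :=
      add_nonneg (hnn _ _) (by split_ifs <;> simp)
    dsimp only at hlt ⊢
    rcases le_or_gt t (H l0) with hcase | hcase
    · have hm : max 0 (t - H l0) = 0 := max_eq_left (by linarith)
      simp only [hm, ite_self, add_zero] at hlt ⊢
      rw [hpos i _ (lt_of_le_of_lt hsnn hlt)]
      exact hle k _ fun hk => (hl0 k hk).trans (hlam t)
    · obtain ⟨hz0, rfl⟩ := hz.resolve_right (by linarith [ht.2])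
      have hHt : H (lam t) = H 0 := by
        rw [hHlam, min_eq_right hcase.le, max_eq_right (hHnn _)]
      have heq : ∀ k, h k (lam t) = h k 0 := fun k =>
        le_antisymm (hcmp _ _ hHt.le k) (hcmp _ _ hHt.ge k)
      have hk0 : ∀ k, f k (h k (lam t) + if k = z then max 0 (t - H 0) else 0) ≤ 0 := by
        intro k
        by_cases hk : f k = 0
        · simp [hk]
        · have : k ≠ z := by rintro rfl; exact hk hz0
          simp only [this, if_false, add_zero, heq]
          exact hle k 0 fun _ => le_rfl
      refine (hk0 k).trans ?_
      by_cases hi : f i = 0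
      · simp [hi]
      · have : i ≠ z := by rintro rfl; exact hi hz0
        simp only [this, if_false, add_zero, heq] at hlt hsnn ⊢
        exact (hpos i 0 (lt_of_le_of_lt hsnn hlt)).ge

end OnlineMatching

end

noncomputable section

namespace OnlineMatching

theorem one_sub_inv_exp_pos : 0 < 1 - 1 / Real.exp 1 := by
  have : 1 < Real.exp 1 := Real.one_lt_exp_iff.2 one_pos
  rw [sub_pos, div_lt_one (by positivity)]
  exact this

theorem g_pos (y : ℝ) : 0 < g y := div_pos (Real.exp_pos _) one_sub_inv_exp_pos

theorem g_mono : Monotone g := fun a b h => by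
  unfold g
  gcongr
  exact one_sub_inv_exp_pos.le

namespace BudgetInstance

variable {L : Type*} [DecidableEq L] {n : ℕ} (I : BudgetInstance L n)

/-! ### Dependence on the past -/

theorem load_congr {E E' : Assignment L n} {j : Fin n} (h : ∀ k < j, E k = E' k) (i : L) :
    I.load E j i = I.load E' j i :=
  Finset.sum_congr rfl fun k hk => by simp only [X, h k (mem_Iio.1 hk)]

theorem gain_congr {E E' : Assignment L n} {j : Fin n} (h : ∀ k < j, E k = E' k) (i : L) :
    I.gain E j i = I.gain E' j i := by
  simp only [gain, I.load_congr h]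

theorem Y_congr {E E' : Assignment L n} {j : Fin n} (h : ∀ k < j, E k = E' k) (i : L) :
    I.Y E j i = I.Y E' j i :=
  Finset.sum_congr rfl fun k hk => by
    have hk := mem_Iio.1 hk
    simp only [X, h k hk, I.gain_congr (fun l hl => h l (hl.trans hk))]

theorem increaseB_congr {E E' : Assignment L n} {j : Fin n} (h : ∀ k < j, E k = E' k) (i : L)
    (r s : ℝ) : I.increaseB E j i r s = I.increaseB E' j i r s := by
  simp only [increaseB, I.gain_congr h, I.Y_congr h]

theorem B_congr {x x' : Fin n → Assignment L n → L → ℝ} {E E' : Assignment L n} {j : Fin n}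
    (h : ∀ k < j, E k = E' k) (hx : ∀ k < j, x k E = x' k E') (i : L) :
    I.B x E j i = I.B x' E' j i :=
  Finset.sum_congr rfl fun k hk => by
    have hk := mem_Iio.1 hk
    simp only [X, h k hk, I.increaseB_congr (fun l hl => h l (hl.trans hk)), hx k hk]

theorem score_congr {x x' : Fin n → Assignment L n → L → ℝ} {E E' : Assignment L n} {j : Fin n}
    (h : ∀ k < j, E k = E' k) (hx : ∀ k < j, x k E = x' k E') :
    I.score x E j = I.score x' E' j := by
  funext ξ i
  simp only [score, I.gain_congr h, I.B_congr h hx, I.increaseB_congr h]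

theorem IsLoop.congr [Fintype L] {I : BudgetInstance L n}
    {x x' : Fin n → Assignment L n → L → ℝ} {E E' : Assignment L n} {j : Fin n} {ξ : ℝ → L → ℝ}
    (hl : I.IsLoop x E j ξ) (h : I.score x E j = I.score x' E' j) : I.IsLoop x' E' j ξ :=
  ⟨hl.start, hl.mono, hl.total, by simpa only [h] using hl.greedy⟩

/-! ### Elementary properties of the score -/

theorem gain_nonneg (E : Assignment L n) (j : Fin n) (i : L) : 0 ≤ I.gain E j i :=
  le_min (I.weight_nonneg i j) (le_max_left _ _)

theorem gain_div_nonneg (E : Assignment L n) (j : Fin n) (i : L) :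
    0 ≤ I.gain E j i / I.budget i :=
  div_nonneg (I.gain_nonneg E j i) (I.budget_pos i).le

theorem increaseB_eq (E : Assignment L n) (j : Fin n) (i : L) (r s : ℝ) :
    I.increaseB E j i r s = I.gain E j i * (s * g (I.Y E j i) + r * s ^ 2 / 2 *
      (g (I.Y E j i + I.gain E j i / I.budget i) - g (I.Y E j i))) := by
  unfold increaseB
  rw [intervalIntegral.integral_const_mul]
  congr 1
  set a := g (I.Y E j i)
  set b := g (I.Y E j i + I.gain E j i / I.budget i)
  have : ∀ t : ℝ, (1 - r * t) * a + r * t * b = a + r * (b - a) * t := fun t => by ring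
  simp only [this]
  rw [intervalIntegral.integral_add (by simp) (by
      exact (continuous_const.mul continuous_id).intervalIntegrable _ _),
    intervalIntegral.integral_const_mul, integral_id]
  simp
  ring

theorem increaseB_one_mono (E : Assignment L n) (j : Fin n) (i : L) :
    MonotoneOn (I.increaseB E j i 1) (Set.Ici 0) := by
  intro s hs t ht hst
  have hs : 0 ≤ s := hs
  rw [increaseB_eq, increaseB_eq]
  have hg := (g_pos (I.Y E j i)).le
  have hd : 0 ≤ g (I.Y E j i + I.gain E j i / I.budget i) - g (I.Y E j i) :=
    sub_nonneg.2 (g_mono (by linarith [I.gain_div_nonneg E j i]))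
  have := I.gain_nonneg E j i
  gcongr

-- The score of `i` reads only the fraction of `i`, so constant families suffice. For positive gain
-- it is a quadratic in that fraction with negative linear and nonpositive quadratic coefficient.
open Filter in
theorem score_fraction_dichotomy (x : Fin n → Assignment L n → L → ℝ) (E : Assignment L n)
    (j : Fin n) (i : L) :
    (fun s => I.score x E j (fun _ => s) i) = 0 ∨
      (StrictAntiOn (fun s => I.score x E j (fun _ => s) i) (Set.Ici 0) ∧
        Continuous (fun s => I.score x E j (fun _ => s) i) ∧
        Tendsto (fun s => I.score x E j (fun _ => s) i) atTop atBot) := by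
  rcases (I.gain_nonneg E j i).eq_or_lt with h0 | h0
  · left
    funext s
    simp [score, ← h0]
  right
  have hW := I.budget_pos i
  have hg := g_pos (I.Y E j i)
  have hd : 0 ≤ g (I.Y E j i + I.gain E j i / I.budget i) - g (I.Y E j i) :=
    sub_nonneg.2 (g_mono (by linarith [I.gain_div_nonneg E j i]))
  simp only [score, increaseB_eq]
  set m := I.gain E j i
  set W := I.budget i
  set a := g (I.Y E j i)
  set Δ := g (I.Y E j i + m / W) - a
  set b := I.B x E j i
  have heq : ∀ s : ℝ, m * (1 - (b + m * (s * a + 1 * s ^ 2 / 2 * Δ)) / W) =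
      m * (1 - b / W) - (m ^ 2 / W * a * s + m ^ 2 / W * Δ / 2 * s ^ 2) := fun s => by
    field_simp
    ring
  simp only [heq]
  have hc1 : 0 < m ^ 2 / W * a := by positivity
  have hc2 : 0 ≤ m ^ 2 / W * Δ / 2 := by positivity
  refine ⟨?_, by fun_prop, ?_⟩
  · intro s hs t ht hst
    have hs : 0 ≤ s := hs
    dsimp only
    have h1 : m ^ 2 / W * a * s < m ^ 2 / W * a * t := by gcongr
    have h2 : m ^ 2 / W * Δ / 2 * s ^ 2 ≤ m ^ 2 / W * Δ / 2 * t ^ 2 := by gcongr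
    linarith
  · have h1 : Tendsto (fun s : ℝ => m * (1 - b / W) + -(m ^ 2 / W * a) * s) atTop atBot :=
      tendsto_atBot_add_const_left _ _
        (tendsto_id.const_mul_atTop_of_neg (neg_neg_of_pos hc1))
    refine tendsto_atBot_mono (fun s => ?_) h1
    have : 0 ≤ m ^ 2 / W * Δ / 2 * s ^ 2 := by positivity
    linarith

/-! ### Existence of a run -/

theorem exists_isLoop [Fintype L] [Nonempty L] (x : Fin n → Assignment L n → L → ℝ)
    (E : Assignment L n) (j : Fin n) : ∃ ξ, I.IsLoop x E j ξ := by
  obtain ⟨ξ, h1, h2, h3, h4⟩ := exists_waterFilling (I.score_fraction_dichotomy x E j)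
  exact ⟨ξ, h1, h2, h3, h4⟩

theorem exists_isRun [Fintype L] : ∃ x, I.IsRun x := by
  suffices h : ∀ m ≤ n, ∃ x : Fin n → Assignment L n → L → ℝ,
      (∀ j E E', (∀ k < j, E k = E' k) → x j E = x j E') ∧
      ∀ j : Fin n, (j : ℕ) < m → ∀ E, ((∀ i, 1 ≤ I.Y E j i) → ∀ i, x j E i = 0) ∧
        ((∃ i, I.Y E j i < 1) → ∃ ξ : ℝ → L → ℝ, I.IsLoop x E j ξ ∧ x j E = ξ 1) by
    obtain ⟨x, hx, h⟩ := h n le_rfl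
    exact ⟨x, hx, fun j E => (h j j.2 E).1, fun j E => (h j j.2 E).2⟩
  intro m
  induction m with
  | zero => exact fun _ => ⟨fun _ _ _ => 0, fun _ _ _ _ => rfl, fun j hj => absurd hj (by simp)⟩
  | succ m ih =>
    intro hm
    obtain ⟨x, hx, h⟩ := ih (by omega)
    set j : Fin n := ⟨m, hm⟩ with hj
    -- Erasing the choices from `j` on before choosing a loop makes the chosen fractions depend on
    -- the past only.
    set past : Assignment L n → Assignment L n := fun E k => if k < j then E k else none with hp
    have hpast : ∀ E, ∀ k < j, past E k = E k := fun E k hk => by simp [hp, hk]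
    have hsol : ∀ E, ∃ v : L → ℝ, ((∀ i, 1 ≤ I.Y E j i) → ∀ i, v i = 0) ∧
        ((∃ i, I.Y E j i < 1) → ∃ ξ : ℝ → L → ℝ, I.IsLoop x E j ξ ∧ v = ξ 1) := by
      intro E
      by_cases hE : ∃ i, I.Y E j i < 1
      · obtain ⟨i, hi⟩ := hE
        have : Nonempty L := ⟨i⟩
        obtain ⟨ξ, hξ⟩ := I.exists_isLoop x E j
        exact ⟨ξ 1, fun h => absurd (h i) (not_le.2 hi), fun _ => ⟨ξ, hξ, rfl⟩⟩
      · exact ⟨0, fun _ _ => rfl, fun h => absurd h hE⟩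
    choose v hv0 hv1 using hsol
    set x' : Fin n → Assignment L n → L → ℝ := Function.update x j (fun E => v (past E)) with hx'
    have hx'j : ∀ E, x' j E = v (past E) := fun E => by simp [hx']
    have hx'k : ∀ k, k ≠ j → x' k = x k := fun k hk => by simp [hx', hk]
    refine ⟨x', ?_, ?_⟩
    · intro k E E' hE
      by_cases hk : k = j
      · subst hk
        have : past E = past E' := by
          funext l
          by_cases hl : l < j
          · simp [hp, hl, hE l hl]
          · simp [hp, hl]
        rw [hx'j, hx'j, this]
      · rw [hx'k k hk]
        exact hx k E E' hE
    · intro k hk E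
      rcases (Nat.lt_succ_iff.1 hk).eq_or_lt with hkm | hkm
      · have : k = j := Fin.ext hkm
        subst this
        simp only [hx'j]
        have hY : ∀ i, I.Y (past E) j i = I.Y E j i := I.Y_congr (hpast E)
        constructor
        · intro hE
          exact hv0 _ fun i => by rw [hY]; exact hE i
        · rintro ⟨i, hi⟩
          obtain ⟨ξ, hξ, hv⟩ := hv1 (past E) ⟨i, by rw [hY]; exact hi⟩
          refine ⟨ξ, hξ.congr (I.score_congr (hpast E) fun l hl => ?_), hv⟩
          rw [hx'k l hl.ne]
          exact hx l _ _ fun p hp => hpast E p (hp.trans hl)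
      · have hne : k ≠ j := fun h => by simp [h, hj] at hkm
        obtain ⟨h1, h2⟩ := h k hkm E
        rw [hx'k k hne]
        refine ⟨h1, fun hE => ?_⟩
        obtain ⟨ξ, hξ, hv⟩ := h2 hE
        refine ⟨ξ, hξ.congr (I.score_congr (fun _ _ => rfl) fun l hl => ?_), hv⟩
        rw [hx'k l]
        rintro rfl
        have : (j : ℕ) < k := hl
        simp only [hj] at this
        omega

/-! ### Consequences of the greedy rule -/

variable {I} [Fintype L] {x : Fin n → Assignment L n → L → ℝ}

theorem IsRun.fraction_nonneg (hx : I.IsRun x) (j : Fin n) (E : Assignment L n) (i : L) :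
    0 ≤ x j E i := by
  by_cases hE : ∃ i, I.Y E j i < 1
  · obtain ⟨ξ, hξ, h⟩ := hx.loop j E hE
    rw [h, ← hξ.start i]
    exact hξ.mono i (by simp) (by simp) zero_le_one
  · push Not at hE
    exact (hx.idle j E hE i).ge

theorem IsRun.sum_fraction_le_one (hx : I.IsRun x) (j : Fin n) (E : Assignment L n) :
    ∑ i, x j E i ≤ 1 := by
  by_cases hE : ∃ i, I.Y E j i < 1
  · obtain ⟨ξ, hξ, h⟩ := hx.loop j E hE
    rw [h, hξ.total 1 (by simp)]
  · push Not at hE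
    simp [hx.idle j E hE]

theorem IsRun.isAdapted (hx : I.IsRun x) : IsAdapted x :=
  fun j E E' h => hx.adapted j E E' fun k hk => h k hk

/-- At some moment `i` attains the maximum. Scores fall in time, so the final score of `k` is at
most its score then, which is at most that of `i` then, and so at most the initial score of `i`. -/
theorem IsRun.score_le_of_pos (hx : I.IsRun x) {j : Fin n} {E : Assignment L n}
    (hE : ∃ i, I.Y E j i < 1) {i : L} (hi : 0 < x j E i) (k : L) :
    I.score x E j (x j E) k ≤ I.gain E j i * (1 - I.B x E j i / I.budget i) := by
  obtain ⟨ξ, hξ, h⟩ := hx.loop j E hE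
  rw [h] at hi
  have h01 : (0 : ℝ) ∈ Set.Icc (0 : ℝ) 1 := by simp
  have h11 : (1 : ℝ) ∈ Set.Icc (0 : ℝ) 1 := by simp
  obtain ⟨u, hu, hgr⟩ := hξ.greedy i 0 h01 1 h11 one_pos (by rwa [hξ.start])
  have hnn : ∀ k, 0 ≤ ξ u k := fun k => by
    rw [← hξ.start k]; exact hξ.mono k h01 hu hu.1
  have hle : ∀ k, ξ u k ≤ ξ 1 k := fun k => hξ.mono k hu h11 hu.2
  refine le_trans ?_ ((hgr k).trans ?_)
  · unfold score
    have := I.increaseB_one_mono E j k (hnn k) ((hnn k).trans (hle k)) (hle k)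
    have := I.gain_nonneg E j k
    have := (I.budget_pos k).le
    rw [h]
    gcongr
  · unfold score
    have h0 : I.increaseB E j i 1 0 = 0 := by simp [increaseB]
    have := I.increaseB_one_mono E j i (Set.mem_Ici.2 le_rfl) (hnn i) (hnn i)
    rw [h0] at this
    have := I.gain_nonneg E j i
    have := (I.budget_pos i).le
    gcongr
    linarith

/-- The initial scores, weighted by the final fractions, are at least every final score. -/
theorem IsRun.score_le_sum (hx : I.IsRun x) {j : Fin n} {E : Assignment L n}
    (hE : ∃ i, I.Y E j i < 1) (k : L) :
    I.score x E j (x j E) k ≤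
      ∑ i, x j E i * (I.gain E j i * (1 - I.B x E j i / I.budget i)) := by
  have hs : ∑ i, x j E i = 1 := by
    obtain ⟨ξ, hξ, h⟩ := hx.loop j E hE
    rw [h, hξ.total 1 (by simp)]
  calc I.score x E j (x j E) k = ∑ i, x j E i * I.score x E j (x j E) k := by
        rw [← Finset.sum_mul, hs, one_mul]
    _ ≤ _ := Finset.sum_le_sum fun i _ => by
        rcases (hx.fraction_nonneg j E i).eq_or_lt with h | h
        · simp [← h]
        · exact mul_le_mul_of_nonneg_left (hx.score_le_of_pos hE h k) h.le

end BudgetInstance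

end OnlineMatching

end

noncomputable section

namespace OnlineMatching

/-! ### Estimates for `g` -/

theorem g_one_le_two : g 1 ≤ 2 := by
  have h : 2 ≤ Real.exp 1 := by linarith [Real.add_one_le_exp (1 : ℝ)]
  have h2 : 1 / Real.exp 1 ≤ 1 / 2 := one_div_le_one_div_of_le two_pos h
  unfold g
  rw [sub_self, Real.exp_zero, div_le_iff₀ one_sub_inv_exp_pos]
  linarith

/-- This is what the normalization of `g` is for: `g - g 0` runs from `0` to `1` on the unit
interval. -/
theorem g_one_eq : g 1 = 1 + g 0 := by
  have h := one_sub_inv_exp_pos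
  unfold g
  rw [sub_self, Real.exp_zero, zero_sub, Real.exp_neg, div_eq_iff h.ne', add_mul,
    div_mul_cancel₀ _ h.ne', one_div]
  ring

theorem g_add (y d : ℝ) : g (y + d) = g y * Real.exp d := by
  unfold g
  rw [show y + d - 1 = (y - 1) + d by ring, Real.exp_add]
  ring

theorem mul_g_le_sub (y d : ℝ) : d * g y ≤ g (y + d) - g y := by
  rw [g_add]
  have := mul_le_mul_of_nonneg_left (Real.add_one_le_exp d) (g_pos y).le
  linarith

theorem sub_le_mul_g (y d : ℝ) : g (y + d) - g y ≤ d * g (y + d) := by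
  have h := mul_g_le_sub (y + d) (-d)
  rw [add_neg_cancel_right] at h
  linarith

/-- With `mul_g_le_sub`, a discrete form of $g'=g$. -/
theorem one_sub_mul_sub_le (y d : ℝ) : (1 - d) * (g (y + d) - g y) ≤ d * g y := by
  have h := sub_le_mul_g y d
  linarith

/-- By convexity `g` lies below its chord over $[0,1]$, which has slope `g 1 - g 0 = 1`. -/
theorem g_sub_g_zero_le {y : ℝ} (h0 : 0 ≤ y) (h1 : y ≤ 1) : g y - g 0 ≤ y := by
  have hc := convexOn_exp.2 (Set.mem_univ (-1 : ℝ)) (Set.mem_univ 0) (sub_nonneg.2 h1) h0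
    (by ring)
  simp only [smul_eq_mul] at hc
  have h := one_sub_inv_exp_pos
  have e1 : Real.exp (-1) = 1 / Real.exp 1 := by rw [Real.exp_neg, one_div]
  rw [show (1 - y) * -1 + y * 0 = y - 1 by ring, Real.exp_zero, e1] at hc
  unfold g
  rw [zero_sub, e1, ← sub_div, div_le_iff₀ h]
  linarith

/-- Trades the absolute value of the noise for its square, which can be computed by martingale
methods. -/
theorem abs_le_of_pos {θ : ℝ} (hθ : 0 < θ) (a : ℝ) : |a| ≤ θ / 2 + a ^ 2 / (2 * θ) := by
  have h := sq_nonneg (|a| - θ)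
  have h2 : |a| ≤ (θ ^ 2 + a ^ 2) / (2 * θ) := by
    rw [le_div_iff₀ (by positivity), ← sq_abs a]
    linarith
  refine h2.trans (le_of_eq ?_)
  field_simp

/-! ### Partial sums over the earlier vertices -/

section SumBefore

variable {n : ℕ}

/-- The sum of `f` over the online vertices before time `t`. -/
def sumBefore (t : ℕ) (f : Fin n → ℝ) : ℝ :=
  ∑ k ∈ univ.filter (fun k : Fin n => (k : ℕ) < t), f k

theorem sumBefore_zero (f : Fin n → ℝ) : sumBefore 0 f = 0 := by simp [sumBefore]

theorem sumBefore_succ (j : Fin n) (f : Fin n → ℝ) :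
    sumBefore (j + 1) f = sumBefore j f + f j := by
  unfold sumBefore
  rw [filter_val_lt_succ, Finset.sum_insert (by simp), add_comm]

theorem sumBefore_self (f : Fin n → ℝ) : sumBefore n f = ∑ k, f k := by
  unfold sumBefore
  rw [Finset.filter_true_of_mem fun k _ => k.2]

theorem sum_Iio_eq_sumBefore (j : Fin n) (f : Fin n → ℝ) :
    ∑ k ∈ Iio j, f k = sumBefore j f := by
  unfold sumBefore
  congr 1
  ext k
  simp

theorem sumBefore_mono {f : Fin n → ℝ} (hf : ∀ k, 0 ≤ f k) {s t : ℕ} (h : s ≤ t) :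
    sumBefore s f ≤ sumBefore t f := by
  refine Finset.sum_le_sum_of_subset_of_nonneg (fun k hk => ?_) fun k _ _ => hf k
  simp only [mem_filter, mem_univ, true_and] at hk ⊢
  omega

theorem dependsOn_sumBefore {L : Type*} {f : Assignment L n → Fin n → ℝ} {t : ℕ}
    (h : ∀ k : Fin n, (k : ℕ) < t → DependsOn (fun M => f M k) {l | (l : ℕ) < t}) :
    DependsOn (fun M => sumBefore t (f M)) {l | (l : ℕ) < t} :=
  fun _ _ hM => Finset.sum_congr rfl fun k hk => h k (Finset.mem_filter.1 hk).2 hM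

theorem induction_time {P : ℕ → Prop} (h0 : P 0) (hs : ∀ j : Fin n, P j → P (j + 1)) :
    ∀ t ≤ n, P t := by
  intro t
  induction t with
  | zero => exact fun _ => h0
  | succ t ih => exact fun ht => hs ⟨t, ht⟩ (ih (by omega))

end SumBefore

/-! ### The level of one offline vertex -/

section Level

variable {L : Type*} [DecidableEq L] {n : ℕ}

theorem X_nonneg (M : Assignment L n) (i : L) (j : Fin n) : 0 ≤ X M i j := by
  unfold X; split_ifs <;> norm_num

theorem X_le_one (M : Assignment L n) (i : L) (j : Fin n) : X M i j ≤ 1 := by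
  unfold X; split_ifs <;> norm_num

theorem X_eq_zero_or_one (M : Assignment L n) (i : L) (j : Fin n) : X M i j = 0 ∨ X M i j = 1 := by
  unfold X; split_ifs <;> simp

theorem dependsOn_X (i : L) (j : Fin n) :
    DependsOn (fun M : Assignment L n => X M i j) {k | (k : ℕ) < j + 1} := by
  intro M M' h
  have : M j = M' j := h j (Nat.lt_succ_self _)
  simp only [X, this]

/-- The level of `i` at time `t`, if the assignment of `k` to `i` raises it by `d M k`. -/
def level (i : L) (d : Assignment L n → Fin n → ℝ) (M : Assignment L n) (t : ℕ) : ℝ :=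
  sumBefore t fun k => d M k * X M i k

/-- The increase of `g (level)` if `j` is assigned to `i`. -/
def jump (i : L) (d : Assignment L n → Fin n → ℝ) (M : Assignment L n) (j : Fin n) : ℝ :=
  g (level i d M j + d M j) - g (level i d M j)

/-- The predictable part of `g (level)`. -/
def compensator (x : Fin n → Assignment L n → L → ℝ) (i : L) (d : Assignment L n → Fin n → ℝ)
    (M : Assignment L n) (t : ℕ) : ℝ :=
  sumBefore t fun k => x k M i * jump i d M k

/-- The difference of the predictable part of `g (level)` and `g (level)`, a martingale. -/
def noise (x : Fin n → Assignment L n → L → ℝ) (i : L) (d : Assignment L n → Fin n → ℝ)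
    (M : Assignment L n) (t : ℕ) : ℝ :=
  sumBefore t fun k => (x k M i - X M i k) * jump i d M k

theorem g_level_succ (i : L) (d : Assignment L n → Fin n → ℝ) (M : Assignment L n) (j : Fin n) :
    g (level i d M (j + 1)) = g (level i d M j) + jump i d M j * X M i j := by
  have : level i d M (j + 1) = level i d M j + d M j * X M i j := sumBefore_succ j _
  rw [this, jump]
  rcases X_eq_zero_or_one M i j with h | h <;> simp [h]

/-- The Doob decomposition of `g (level)`. -/
theorem noise_eq (x : Fin n → Assignment L n → L → ℝ) (i : L) (d : Assignment L n → Fin n → ℝ)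
    (M : Assignment L n) {t : ℕ} (ht : t ≤ n) :
    noise x i d M t = compensator x i d M t - (g (level i d M t) - g 0) := by
  refine induction_time (P := fun t => noise x i d M t =
    compensator x i d M t - (g (level i d M t) - g 0)) ?_ (fun j hj => ?_) t ht
  · simp [noise, compensator, level, sumBefore_zero]
  · rw [g_level_succ]
    rw [noise, compensator, sumBefore_succ, sumBefore_succ]
    change noise x i d M j + _ = compensator x i d M j + _ - _
    rw [hj]
    ring

/-- The increments `d` of the level of `i` are determined by the past, at most `δ`, and never lift
the level above `1`. -/
structure IsSmallIncrement (i : L) (d : Assignment L n → Fin n → ℝ) (δ : ℝ) : Prop where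
  adapted : ∀ j : Fin n, DependsOn (fun M => d M j) {k | (k : ℕ) < j}
  nonneg : ∀ M j, 0 ≤ d M j
  le : ∀ M j, d M j ≤ δ
  level_add_le : ∀ M (j : Fin n), level i d M j + d M j ≤ 1

namespace IsSmallIncrement

variable {i : L} {d : Assignment L n → Fin n → ℝ} {δ : ℝ}

theorem level_nonneg (hd : IsSmallIncrement i d δ) (M : Assignment L n) (t : ℕ) :
    0 ≤ level i d M t := by
  unfold level sumBefore
  exact Finset.sum_nonneg fun k _ => mul_nonneg (hd.nonneg M k) (X_nonneg M i k)

theorem level_le_one (hd : IsSmallIncrement i d δ) (M : Assignment L n) {t : ℕ} (ht : t ≤ n) :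
    level i d M t ≤ 1 := by
  refine induction_time (P := fun t => level i d M t ≤ 1) (by simp [level, sumBefore_zero])
    (fun j _ => ?_) t ht
  have : level i d M (j + 1) = level i d M j + d M j * X M i j := sumBefore_succ j _
  have h1 := mul_le_mul_of_nonneg_left (X_le_one M i j) (hd.nonneg M j)
  linarith [hd.level_add_le M j]

theorem dependsOn_level (hd : IsSmallIncrement i d δ) (t : ℕ) :
    DependsOn (fun M => level i d M t) {k | (k : ℕ) < t} := by
  refine dependsOn_sumBefore fun k hk M M' h => ?_
  have h1 : d M k = d M' k := hd.adapted k fun l hl => h l (lt_trans hl hk)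
  have h2 : X M i k = X M' i k := dependsOn_X i k fun l hl =>
    h l (lt_of_lt_of_le (show (l : ℕ) < k + 1 from hl) hk)
  simp only [h1, h2]

theorem dependsOn_jump (hd : IsSmallIncrement i d δ) (j : Fin n) :
    DependsOn (fun M => jump i d M j) {k | (k : ℕ) < j} := by
  intro M M' h
  have h1 := hd.adapted j h
  have h2 := hd.dependsOn_level j h
  dsimp only at h1 h2
  simp only [jump, h1, h2]

theorem jump_nonneg (hd : IsSmallIncrement i d δ) (M : Assignment L n) (j : Fin n) :
    0 ≤ jump i d M j :=
  sub_nonneg.2 (g_mono (by linarith [hd.nonneg M j]))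

theorem jump_le (hd : IsSmallIncrement i d δ) (M : Assignment L n) (j : Fin n) :
    jump i d M j ≤ 2 * δ := by
  have h1 := sub_le_mul_g (level i d M j) (d M j)
  have h2 : g (level i d M j + d M j) ≤ 2 := (g_mono (hd.level_add_le M j)).trans g_one_le_two
  have h3 := mul_le_mul_of_nonneg_left h2 (hd.nonneg M j)
  have h4 := hd.le M j
  unfold jump
  linarith

theorem one_sub_mul_jump_le (hd : IsSmallIncrement i d δ) (M : Assignment L n) (j : Fin n) :
    (1 - δ) * jump i d M j ≤ d M j * g (level i d M j) := by
  have h1 := one_sub_mul_sub_le (level i d M j) (d M j)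
  have h2 := mul_le_mul_of_nonneg_right (sub_le_sub_left (hd.le M j) 1) (hd.jump_nonneg M j)
  exact h2.trans h1

theorem dependsOn_noise (hd : IsSmallIncrement i d δ) {x : Fin n → Assignment L n → L → ℝ}
    (hx : IsAdapted x) (t : ℕ) : DependsOn (fun M => noise x i d M t) {k | (k : ℕ) < t} := by
  refine dependsOn_sumBefore fun k hk M M' h => ?_
  have h1 : jump i d M k = jump i d M' k := hd.dependsOn_jump k fun l hl => h l (lt_trans hl hk)
  have h2 : X M i k = X M' i k := dependsOn_X i k fun l hl =>
    h l (lt_of_lt_of_le (show (l : ℕ) < k + 1 from hl) hk)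
  have h3 : x k M = x k M' := hx k fun l hl => h l (lt_trans hl hk)
  simp only [h1, h2, h3]

/-- If `b` is at least `1 - θ ^ 2` times the predictable part of `g (level)`, then
`1 - b` is at most about `1 - (g (level) - g 0)`. -/
theorem one_sub_le {θ : ℝ} (hd : IsSmallIncrement i d (θ ^ 2)) (hθ1 : θ ^ 2 ≤ 1)
    {x : Fin n → Assignment L n → L → ℝ} {M : Assignment L n} {t : ℕ} (ht : t ≤ n) {b : ℝ}
    (hb : (1 - θ ^ 2) * compensator x i d M t ≤ b) :
    1 - b ≤ 1 - (g (level i d M t) - g 0) + θ ^ 2 + |noise x i d M t| := by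
  have hN := noise_eq x i d M ht
  have hG := g_sub_g_zero_le (hd.level_nonneg M t) (hd.level_le_one M ht)
  have hC : compensator x i d M t = g (level i d M t) - g 0 + noise x i d M t := by linarith
  rw [hC] at hb
  have h1 := mul_le_mul_of_nonneg_left (hG.trans (hd.level_le_one M ht)) (sq_nonneg θ)
  have h2 : -((1 - θ ^ 2) * noise x i d M t) ≤ |noise x i d M t| := by
    rw [← mul_neg]
    have := mul_le_mul_of_nonneg_left (neg_le_abs (noise x i d M t)) (sub_nonneg.2 hθ1)
    have := mul_nonneg (sq_nonneg θ) (abs_nonneg (noise x i d M t))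
    linarith
  linarith

end IsSmallIncrement

/-! ### Second moment estimates -/

variable [Fintype L] {x : Fin n → Assignment L n → L → ℝ}

/-- Since `X` is 0-1, a function of the `j`-th step can be written as affine in `X`; a coefficient
known beforehand allows `X` to be replaced by its mean. -/
theorem expectedReward_add_mul_X (hx : IsAdapted x) (i : L) (j : Fin n)
    {H F F' : Assignment L n → ℝ} (hF' : DependsOn F' {k | (k : ℕ) < j})
    (h : ∀ M, H M = F M + F' M * X M i j) :
    expectedReward x H = expectedReward x (fun M => F M + F' M * x j M i) := by
  rw [expectedReward_add, ← expectedReward_mul_X hx i j hF', ← expectedReward_add]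
  exact congrArg _ (funext h)

namespace IsSmallIncrement

variable {i : L} {d : Assignment L n → Fin n → ℝ} {δ : ℝ}

theorem expectedReward_level_succ (hd : IsSmallIncrement i d δ) (hx : IsStrategy x) (j : Fin n) :
    expectedReward x (fun M => level i d M (j + 1)) =
      expectedReward x (fun M => level i d M j) +
        expectedReward x (fun M => d M j * x j M i) := by
  rw [← expectedReward_add]
  exact expectedReward_add_mul_X hx.adapted i j (hd.adapted j) fun M => sumBefore_succ j _

theorem expectedReward_g_level_succ (hd : IsSmallIncrement i d δ) (hx : IsStrategy x)
    (j : Fin n) :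
    expectedReward x (fun M => g (level i d M (j + 1)) - g 0) =
      expectedReward x (fun M => g (level i d M j) - g 0) +
        expectedReward x (fun M => jump i d M j * x j M i) := by
  rw [← expectedReward_add]
  exact expectedReward_add_mul_X hx.adapted i j (hd.dependsOn_jump j) fun M => by
    rw [g_level_succ]; ring

theorem expectedReward_compensator (hd : IsSmallIncrement i d δ) (hx : IsStrategy x) :
    ∀ t ≤ n, expectedReward x (fun M => compensator x i d M t) =
      expectedReward x (fun M => g (level i d M t) - g 0) := by
  refine induction_time ?_ fun j hj => ?_
  · simp [compensator, level, sumBefore_zero]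
  · rw [hd.expectedReward_g_level_succ hx, ← hj, ← expectedReward_add]
    congr 1
    funext M
    rw [compensator, sumBefore_succ, mul_comm (jump i d M j)]
    rfl

theorem expectedReward_sum_increment (hd : IsSmallIncrement i d δ) (hx : IsStrategy x) :
    ∀ t ≤ n, expectedReward x (fun M => sumBefore t fun k => d M k * x k M i) =
      expectedReward x (fun M => level i d M t) := by
  refine induction_time ?_ fun j hj => ?_
  · simp [level, sumBefore_zero]
  · rw [hd.expectedReward_level_succ hx, ← hj, ← expectedReward_add]
    simp only [sumBefore_succ]

/-- The cross terms cancel, and a step adds $x(1-x)J^2\le 2\delta\,xJ$ in conditional mean, where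
$xJ$ is the mean growth of `g (level)`. -/
theorem expectedReward_noise_sq_le (hd : IsSmallIncrement i d δ) (hx : IsStrategy x) :
    ∀ t ≤ n, expectedReward x (fun M => noise x i d M t ^ 2) ≤
      2 * δ * expectedReward x (fun M => g (level i d M t) - g 0) := by
  refine induction_time ?_ fun j hj => ?_
  · simp [noise, level, sumBefore_zero, expectedReward]
  · have hstep : expectedReward x (fun M => noise x i d M (j + 1) ^ 2) =
        expectedReward x (fun M => (noise x i d M j ^ 2 + 2 * noise x i d M j * x j M i *
          jump i d M j + x j M i ^ 2 * jump i d M j ^ 2) +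
          (jump i d M j ^ 2 - 2 * x j M i * jump i d M j ^ 2 -
            2 * noise x i d M j * jump i d M j) * x j M i) := by
      refine expectedReward_add_mul_X hx.adapted i j (fun M M' h => ?_) fun M => ?_
      · have h1 := hd.dependsOn_jump j h
        have h2 := hd.dependsOn_noise hx.adapted j h
        have h3 := hx.adapted j h
        dsimp only at h1 h2
        simp only [h1, h2, h3]
      · have : noise x i d M (j + 1) = noise x i d M j + (x j M i - X M i j) * jump i d M j :=
          sumBefore_succ j _
        rw [this]
        rcases X_eq_zero_or_one M i j with h | h <;> rw [h] <;> ring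
    rw [hstep, hd.expectedReward_g_level_succ hx, mul_add]
    refine le_trans ?_ (add_le_add_left hj _)
    rw [← expectedReward_mul_left, ← expectedReward_add]
    refine hx.mono fun M => ?_
    have hJ := hd.jump_nonneg M j
    have hJ2 := hd.jump_le M j
    have hx0 := hx.nonneg j M i
    have h1 : x j M i * jump i d M j * jump i d M j ≤ x j M i * jump i d M j * (2 * δ) := by
      gcongr
    have h2 : 0 ≤ x j M i ^ 2 * jump i d M j ^ 2 := by positivity
    linarith

/-- The noise, weighted by the increments of the level, is small in mean square. -/
theorem expectedReward_sum_noise_sq_le (hd : IsSmallIncrement i d δ) (hx : IsStrategy x) :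
    ∀ t ≤ n, expectedReward x (fun M => sumBefore t fun k =>
        d M k * x k M i * noise x i d M k ^ 2) ≤
      2 * expectedReward x (fun M => level i d M t * noise x i d M t ^ 2) +
        8 * δ ^ 2 * expectedReward x (fun M => level i d M t) := by
  refine induction_time ?_ fun j hj => ?_
  · simp [noise, level, sumBefore_zero, expectedReward]
  · have hstep : expectedReward x (fun M => level i d M (j + 1) * noise x i d M (j + 1) ^ 2) =
        expectedReward x (fun M => level i d M j * (noise x i d M j ^ 2 +
          2 * noise x i d M j * x j M i * jump i d M j + x j M i ^ 2 * jump i d M j ^ 2) +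
          (level i d M j * (jump i d M j ^ 2 - 2 * x j M i * jump i d M j ^ 2 -
            2 * noise x i d M j * jump i d M j) +
            d M j * (noise x i d M j + (x j M i - 1) * jump i d M j) ^ 2) * x j M i) := by
      refine expectedReward_add_mul_X hx.adapted i j (fun M M' h => ?_) fun M => ?_
      · have h1 := hd.dependsOn_jump j h
        have h2 := hd.dependsOn_noise hx.adapted j h
        have h3 := hx.adapted j h
        have h4 := hd.dependsOn_level j h
        have h5 := hd.adapted j h
        dsimp only at h1 h2 h4 h5
        simp only [h1, h2, h3, h4, h5]
      · have h1 : noise x i d M (j + 1) = noise x i d M j + (x j M i - X M i j) * jump i d M j :=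
          sumBefore_succ j _
        have h2 : level i d M (j + 1) = level i d M j + d M j * X M i j := sumBefore_succ j _
        rw [h1, h2]
        rcases X_eq_zero_or_one M i j with h | h <;> rw [h] <;> ring
    -- Product rule for level times squared noise: the growth of the level meets the noise after a
    -- success, and the growth of the squared noise contributes a nonnegative term that is dropped.
    have hlow : expectedReward x (fun M => level i d M j * noise x i d M j ^ 2) +
        expectedReward x (fun M => 1 / 2 * (d M j * x j M i * noise x i d M j ^ 2) -
          4 * δ ^ 2 * (d M j * x j M i)) ≤
        expectedReward x (fun M => level i d M (j + 1) * noise x i d M (j + 1) ^ 2) := by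
      rw [hstep, ← expectedReward_add]
      refine hx.mono fun M => ?_
      have hJ := hd.jump_nonneg M j
      have hJ2 := hd.jump_le M j
      have hx0 := hx.nonneg j M i
      have hx1 := sub_nonneg.2 (hx.le_one j M i)
      have hd0 := hd.nonneg M j
      have hY := hd.level_nonneg M j
      set N := noise x i d M j
      set J := jump i d M j
      set y := x j M i
      have h1 : 0 ≤ level i d M j * (y * (1 - y) * J ^ 2) := by positivity
      have h2 : ((1 - y) * J) ^ 2 ≤ (2 * δ) ^ 2 := by
        have : (1 - y) * J ≤ 1 * J := by gcongr; linarith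
        exact pow_le_pow_left₀ (by positivity) (by linarith) 2
      -- This is $(N-b)^2\ge N^2/2-b^2$ with $b=(1-y)J\le 2\delta$.
      have h3 : N ^ 2 / 2 - 4 * δ ^ 2 ≤ (N + (y - 1) * J) ^ 2 := by
        have := sq_nonneg (N - 2 * ((1 - y) * J))
        linarith
      have h4 := mul_le_mul_of_nonneg_left h3 (mul_nonneg hd0 hx0)
      linarith
    rw [expectedReward_sub, expectedReward_mul_left, expectedReward_mul_left] at hlow
    rw [hd.expectedReward_level_succ hx]
    simp only [sumBefore_succ, expectedReward_add]
    linarith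

theorem expectedReward_level_nonneg (hd : IsSmallIncrement i d δ) (hx : IsStrategy x) (t : ℕ) :
    0 ≤ expectedReward x (fun M => level i d M t) := by
  rw [← expectedReward_const hx.adapted 0]
  exact hx.mono fun M => hd.level_nonneg M t

theorem expectedReward_g_level_le (hd : IsSmallIncrement i d δ) (hx : IsStrategy x) {t : ℕ}
    (ht : t ≤ n) : expectedReward x (fun M => g (level i d M t) - g 0) ≤
      expectedReward x (fun M => level i d M t) :=
  hx.mono fun M => g_sub_g_zero_le (hd.level_nonneg M t) (hd.level_le_one M ht)

/-- The increment bound is written as `θ ^ 2` so that the typical size of the noise is of order `θ`.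
-/
theorem expectedReward_abs_noise_le {θ : ℝ} (hθ : 0 < θ) (hd : IsSmallIncrement i d (θ ^ 2))
    (hx : IsStrategy x) {t : ℕ} (ht : t ≤ n) :
    expectedReward x (fun M => |noise x i d M t|) ≤ 2 * θ := by
  have h1 : expectedReward x (fun M => g (level i d M t) - g 0) ≤ 1 := by
    refine (hd.expectedReward_g_level_le hx ht).trans ?_
    rw [← expectedReward_const hx.adapted 1]
    exact hx.mono fun M => hd.level_le_one M ht
  have h2 := hd.expectedReward_noise_sq_le hx t ht
  calc expectedReward x (fun M => |noise x i d M t|)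
      ≤ expectedReward x (fun M => θ / 2 + 1 / (2 * θ) * noise x i d M t ^ 2) :=
        hx.mono fun M => (abs_le_of_pos hθ _).trans (le_of_eq (by ring))
    _ = θ / 2 + 1 / (2 * θ) * expectedReward x (fun M => noise x i d M t ^ 2) := by
        rw [expectedReward_add, expectedReward_const hx.adapted, expectedReward_mul_left]
    _ ≤ θ / 2 + 1 / (2 * θ) * (2 * θ ^ 2 * 1) := by
        gcongr
        exact h2.trans (by gcongr)
    _ = θ / 2 + θ := by field_simp
    _ ≤ 2 * θ := by linarith

/-- The discrete form of $\int_0^Y (1-g(y)+g(0))\,dy = g(1)Y-(g(Y)-g(0))$, which uses $g'=g$ and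
$1+g(0)=g(1)$. -/
theorem expectedReward_sum_one_sub_g_le (hd : IsSmallIncrement i d δ) (hx : IsStrategy x) :
    ∀ t ≤ n, expectedReward x (fun M => sumBefore t fun k =>
        d M k * x k M i * (1 - (g (level i d M k) - g 0))) ≤
      g 1 * expectedReward x (fun M => level i d M t) -
        (1 - δ) * expectedReward x (fun M => g (level i d M t) - g 0) := by
  refine induction_time ?_ fun j hj => ?_
  · simp [level, sumBefore_zero, expectedReward]
  · rw [hd.expectedReward_g_level_succ hx, hd.expectedReward_level_succ hx]
    simp only [sumBefore_succ, expectedReward_add]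
    have : expectedReward x (fun M => d M j * x j M i * (1 - (g (level i d M j) - g 0))) ≤
        expectedReward x (fun M => g 1 * (d M j * x j M i) -
          (1 - δ) * (jump i d M j * x j M i)) := by
      refine hx.mono fun M => ?_
      have := mul_le_mul_of_nonneg_right (hd.one_sub_mul_jump_le M j) (hx.nonneg j M i)
      rw [g_one_eq]
      linarith
    rw [expectedReward_sub, expectedReward_mul_left, expectedReward_mul_left] at this
    linarith

/-- The primal-dual inequality for one offline vertex. -/
theorem expectedReward_dual_le {θ : ℝ} (hθ : 0 < θ) (hθ1 : θ ≤ 1 / 2)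
    (hd : IsSmallIncrement i d (θ ^ 2)) (hx : IsStrategy x) {b : Assignment L n → ℕ → ℝ}
    (hlow : ∀ M, ∀ t ≤ n, (1 - θ ^ 2) * compensator x i d M t ≤ b M t)
    (hup : ∀ M, b M n ≤ (1 + θ ^ 2) * compensator x i d M n) :
    expectedReward x (fun M => ∑ k : Fin n, d M k * x k M i * max 0 (1 - b M k)) +
        expectedReward x (fun M => b M n) ≤
      (g 1 + 10 * θ) * expectedReward x (fun M => level i d M n) := by
  have hsq : θ ^ 2 ≤ θ / 2 := by nlinarith
  have h1 := hd.expectedReward_sum_one_sub_g_le hx n le_rfl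
  have h2 := hd.expectedReward_sum_noise_sq_le hx n le_rfl
  have h3 := hd.expectedReward_noise_sq_le hx n le_rfl
  have h4 := hd.expectedReward_compensator hx n le_rfl
  have h5 := hd.expectedReward_sum_increment hx n le_rfl
  have h6 := hd.expectedReward_g_level_le hx le_rfl
  have h7 := hd.expectedReward_level_nonneg hx n
  have h8 : expectedReward x (fun M => level i d M n * noise x i d M n ^ 2) ≤
      expectedReward x (fun M => noise x i d M n ^ 2) :=
    hx.mono fun M => by
      have := mul_le_mul_of_nonneg_right (hd.level_le_one M le_rfl) (sq_nonneg (noise x i d M n))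
      linarith
  have h9 : expectedReward x (fun M => b M n) ≤
      (1 + θ ^ 2) * expectedReward x (fun M => g (level i d M n) - g 0) := by
    rw [← h4, ← expectedReward_mul_left]
    exact hx.mono hup
  have h10 : expectedReward x (fun M => ∑ k : Fin n, d M k * x k M i * max 0 (1 - b M k)) ≤
      expectedReward x (fun M =>
        sumBefore n (fun k => d M k * x k M i * (1 - (g (level i d M k) - g 0))) +
        (θ ^ 2 + θ / 2) * sumBefore n (fun k => d M k * x k M i) +
        1 / (2 * θ) * sumBefore n (fun k => d M k * x k M i * noise x i d M k ^ 2)) := by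
    refine hx.mono fun M => ?_
    simp only [sumBefore_self, Finset.mul_sum, ← Finset.sum_add_distrib]
    refine Finset.sum_le_sum fun k _ => ?_
    have hdx := mul_nonneg (hd.nonneg M k) (hx.nonneg k M i)
    have hk := k.2.le
    have hb := hd.one_sub_le (by nlinarith) hk (hlow M k hk)
    have hG := (g_sub_g_zero_le (hd.level_nonneg M k) (hd.level_le_one M hk)).trans
      (hd.level_le_one M hk)
    have hN := abs_le_of_pos hθ (noise x i d M k)
    -- The right side is nonnegative because `g - g 0` is at most `1` on the unit interval, so
    -- taking the positive part costs nothing.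
    have hmax : max 0 (1 - b M k) ≤ 1 - (g (level i d M k) - g 0) + (θ ^ 2 + θ / 2) +
        1 / (2 * θ) * noise x i d M k ^ 2 := by
      have e : noise x i d M k ^ 2 / (2 * θ) = 1 / (2 * θ) * noise x i d M k ^ 2 := by ring
      refine max_le ?_ (by linarith)
      have : 0 ≤ 1 / (2 * θ) * noise x i d M k ^ 2 := by positivity
      have := sq_nonneg θ
      linarith
    have := mul_le_mul_of_nonneg_left hmax hdx
    linarith
  rw [expectedReward_add, expectedReward_add, expectedReward_mul_left, expectedReward_mul_left,
    h5] at h10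
  have hθ2 : 0 ≤ θ ^ 2 := sq_nonneg θ
  set EY := expectedReward x (fun M => level i d M n)
  set EG := expectedReward x (fun M => g (level i d M n) - g 0)
  have h11 : 2 * θ ^ 2 * EG ≤ 2 * θ ^ 2 * EY := by gcongr
  have h12 : (θ ^ 2) ^ 2 ≤ θ ^ 2 := by nlinarith
  have h12' : (θ ^ 2) ^ 2 * EY ≤ θ ^ 2 * EY := by gcongr
  -- Here 12 = 4 + 8: the level is at most `1`, so the first term of `h2` is at most `4 * θ ^ 2 *
  -- EY`, and `θ ^ 4 ≤ θ ^ 2` in the second.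
  have h13 : expectedReward x (fun M => sumBefore n fun k =>
        d M k * x k M i * noise x i d M k ^ 2) ≤ 12 * θ ^ 2 * EY := by linarith
  have h14 : 1 / (2 * θ) * expectedReward x (fun M => sumBefore n fun k =>
        d M k * x k M i * noise x i d M k ^ 2) ≤ 6 * θ * EY := by
    calc _ ≤ 1 / (2 * θ) * (12 * θ ^ 2 * EY) := by gcongr
      _ = 6 * θ * EY := by field_simp; ring
  have h15 : θ ^ 2 * EY ≤ θ / 2 * EY := by gcongr
  have h16 : 0 ≤ θ * EY := by positivity
  linarith

end IsSmallIncrement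

end Level

end OnlineMatching

end

noncomputable section

namespace OnlineMatching

/-! ### The competitive ratio -/

namespace BudgetInstance

variable {L : Type*} [DecidableEq L] {n : ℕ} {I : BudgetInstance L n}

/-- The relative increase of the level of `i` if `j` is assigned to `i`. -/
def increment (I : BudgetInstance L n) (i : L) (M : Assignment L n) (j : Fin n) : ℝ :=
  I.gain M j i / I.budget i

theorem Y_eq_level (M : Assignment L n) (j : Fin n) (i : L) :
    I.Y M j i = level i (I.increment i) M j :=
  sum_Iio_eq_sumBefore j _

theorem budget_mul_increment (M : Assignment L n) (j : Fin n) (i : L) :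
    I.budget i * I.increment i M j = I.gain M j i :=
  mul_div_cancel₀ _ (I.budget_pos i).ne'

/-- The truncation in the gain makes the level record exactly the capped load, so the final levels
give the reward. -/
theorem budget_mul_level (M : Assignment L n) (i : L) : ∀ t ≤ n,
    I.budget i * level i (I.increment i) M t =
      min (I.budget i) (sumBefore t fun k => I.weight i k * X M i k) := by
  refine induction_time ?_ fun j hj => ?_
  · simp [level, sumBefore_zero, (I.budget_pos i).le]
  · have h1 : level i (I.increment i) M (j + 1) =
        level i (I.increment i) M j + I.increment i M j * X M i j := sumBefore_succ j _
    have hload : I.load M j i = sumBefore j fun k => I.weight i k * X M i k :=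
      sum_Iio_eq_sumBefore j _
    rw [h1, sumBefore_succ, mul_add, hj, ← mul_assoc, budget_mul_increment, gain, hload]
    have hw := I.weight_nonneg i j
    set S := sumBefore j fun k => I.weight i k * X M i k
    rcases X_eq_zero_or_one M i j with h | h
    · simp [h]
    · rw [h, mul_one, mul_one]
      rcases le_total (I.budget i) S with hS | hS
      · rw [min_eq_left hS, max_eq_left (by linarith), min_eq_right hw,
          min_eq_left (by linarith), add_zero]
      · rw [min_eq_right hS, max_eq_right (by linarith), ← min_add_add_left, min_comm]
        congr 1
        ring

theorem budget_mul_level_le (M : Assignment L n) (j : Fin n) (i : L) :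
    I.budget i * level i (I.increment i) M j + I.gain M j i ≤ I.budget i := by
  have h := budget_mul_level (I := I) M i j j.2.le
  have hload : I.load M j i = sumBefore j fun k => I.weight i k * X M i k :=
    sum_Iio_eq_sumBefore j _
  rw [← hload] at h
  have hg : I.gain M j i ≤ max 0 (I.budget i - I.load M j i) := min_le_right _ _
  rcases le_total (I.budget i) (I.load M j i) with hS | hS
  · rw [max_eq_left (by linarith)] at hg
    rw [h, min_eq_left hS]
    linarith
  · rw [max_eq_right (by linarith)] at hg
    rw [h, min_eq_right hS]
    linarith

theorem isSmallIncrement {δ : ℝ} (hI : ∀ i j, I.weight i j ≤ δ * I.budget i) (i : L) :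
    IsSmallIncrement i (I.increment i) δ where
  adapted j M M' h := by
    simp only [increment, I.gain_congr (fun k hk => h k hk)]
  nonneg M j := I.gain_div_nonneg M j i
  le M j := by
    rw [increment, div_le_iff₀ (I.budget_pos i)]
    exact (min_le_left _ _).trans (hI i j)
  level_add_le M j := by
    have h := budget_mul_level_le (I := I) M j i
    rw [← budget_mul_increment, ← mul_add] at h
    exact le_of_mul_le_mul_left (by linarith) (I.budget_pos i)

/-- Truncation happens only when the remaining budget is below one weight. -/
theorem one_sub_le_level_of_gain_lt {δ : ℝ} (hI : ∀ i j, I.weight i j ≤ δ * I.budget i)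
    (hδ : 0 ≤ δ) {M : Assignment L n} {j : Fin n} {i : L} (h : I.gain M j i < I.weight i j) :
    1 - δ ≤ level i (I.increment i) M j := by
  have hl := budget_mul_level (I := I) M i j j.2.le
  have hload : I.load M j i = sumBefore j fun k => I.weight i k * X M i k :=
    sum_Iio_eq_sumBefore j _
  rw [← hload] at hl
  have hmax : max 0 (I.budget i - I.load M j i) < I.weight i j :=
    (min_lt_iff.1 h).resolve_left (lt_irrefl _)
  have h1 := (le_max_right _ _).trans_lt hmax
  have hW := I.budget_pos i
  have h2 : I.budget i * (1 - δ) ≤ I.budget i * level i (I.increment i) M j := by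
    rw [hl]
    refine le_min ?_ ?_
    · have := mul_nonneg hδ hW.le
      linarith
    · linarith [hI i j]
  exact le_of_mul_le_mul_left h2 hW

/-- `B_i / W_i` at time `t`. -/
def relB (I : BudgetInstance L n) (x : Fin n → Assignment L n → L → ℝ) (i : L)
    (M : Assignment L n) (t : ℕ) : ℝ :=
  sumBefore t fun k => I.increaseB M k i (X M i k / x k M i) (x k M i) / I.budget i

theorem B_div_budget (x : Fin n → Assignment L n → L → ℝ) (i : L) (M : Assignment L n)
    (j : Fin n) : I.B x M j i / I.budget i = I.relB x i M j := by
  rw [relB, ← sum_Iio_eq_sumBefore, B, Finset.sum_div]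

theorem increaseB_div_budget (M : Assignment L n) (j : Fin n) (i : L) (r s : ℝ) :
    I.increaseB M j i r s / I.budget i = I.increment i M j *
      (s * g (level i (I.increment i) M j) + r * s ^ 2 / 2 * jump i (I.increment i) M j) := by
  rw [increaseB_eq, ← budget_mul_increment, jump, Y_eq_level, mul_assoc,
    mul_div_cancel_left₀ _ (I.budget_pos i).ne', mul_div_cancel_left₀ _ (I.budget_pos i).ne']

theorem increaseB_realized_div_budget (x : Fin n → Assignment L n → L → ℝ) (M : Assignment L n)
    (j : Fin n) (i : L) :
    I.increaseB M j i (X M i j / x j M i) (x j M i) / I.budget i = I.increment i M j *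
      (x j M i * g (level i (I.increment i) M j) +
        X M i j * x j M i / 2 * jump i (I.increment i) M j) := by
  rw [increaseB_div_budget]
  congr 4
  -- For a zero fraction both sides vanish, so the value of the division by zero is harmless.
  rcases eq_or_ne (x j M i) 0 with h | h
  · simp [h]
  · field_simp

section

variable {δ : ℝ} {x : Fin n → Assignment L n → L → ℝ} [Fintype L]

theorem increaseB_realized_nonneg (hI : ∀ i j, I.weight i j ≤ δ * I.budget i)
    (hx : IsStrategy x) (i : L) (M : Assignment L n) (k : Fin n) :
    0 ≤ I.increaseB M k i (X M i k / x k M i) (x k M i) / I.budget i := by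
  rw [increaseB_realized_div_budget]
  have hd := isSmallIncrement hI i
  have := hd.nonneg M k
  have := hd.jump_nonneg M k
  have := hx.nonneg k M i
  have := X_nonneg M i k
  have := (g_pos (level i (I.increment i) M k)).le
  positivity

/-- The increment of `relB` is `x * d * g (level)`, comparable with `x * jump`, plus a nonnegative
term of second order. -/
theorem mul_compensator_le_relB (hI : ∀ i j, I.weight i j ≤ δ * I.budget i)
    (hx : IsStrategy x) (i : L) (M : Assignment L n) (t : ℕ) :
    (1 - δ) * compensator x i (I.increment i) M t ≤ I.relB x i M t := by
  rw [compensator, relB, sumBefore, sumBefore, Finset.mul_sum]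
  refine Finset.sum_le_sum fun k _ => ?_
  rw [increaseB_realized_div_budget]
  have hd := isSmallIncrement hI i
  have hx0 := hx.nonneg k M i
  have h1 := mul_le_mul_of_nonneg_left (hd.one_sub_mul_jump_le M k) hx0
  have h2 : 0 ≤ I.increment i M k * (X M i k * x k M i / 2 * jump i (I.increment i) M k) := by
    have := hd.nonneg M k
    have := hd.jump_nonneg M k
    have := X_nonneg M i k
    positivity
  linarith

theorem relB_le_mul_compensator (hI : ∀ i j, I.weight i j ≤ δ * I.budget i)
    (hx : IsStrategy x) (i : L) (M : Assignment L n) (t : ℕ) :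
    I.relB x i M t ≤ (1 + δ) * compensator x i (I.increment i) M t := by
  rw [compensator, relB, sumBefore, sumBefore, Finset.mul_sum]
  refine Finset.sum_le_sum fun k _ => ?_
  rw [increaseB_realized_div_budget]
  have hd := isSmallIncrement hI i
  have hx0 := hx.nonneg k M i
  have hd0 := hd.nonneg M k
  have hJ := hd.jump_nonneg M k
  have h1 : x k M i * (I.increment i M k * g (level i (I.increment i) M k)) ≤
      x k M i * jump i (I.increment i) M k :=
    mul_le_mul_of_nonneg_left (mul_g_le_sub _ _) hx0
  have h2 : I.increment i M k * (X M i k * (x k M i * jump i (I.increment i) M k)) ≤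
      δ * (1 * (x k M i * jump i (I.increment i) M k)) := by
    have := X_le_one M i k
    have hle := hd.le M k
    have := X_nonneg M i k
    have := hd0.trans hle
    gcongr
  have h3 : 0 ≤ I.increment i M k * (X M i k * (x k M i * jump i (I.increment i) M k)) := by
    have := X_nonneg M i k
    positivity
  linarith

/-- The score in the loop averages over the unrealized `X`, while `relB` conditions on its value;
the tower property reconciles them. -/
theorem expectedReward_relB_succ (hI : ∀ i j, I.weight i j ≤ δ * I.budget i)
    (hx : IsStrategy x) (i : L) (j : Fin n) :
    expectedReward x (fun M => (I.B x M j i + I.increaseB M j i 1 (x j M i)) / I.budget i) =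
      expectedReward x (fun M => I.relB x i M (j + 1)) := by
  have hd := isSmallIncrement hI i
  rw [expectedReward_add_mul_X hx.adapted i j (H := fun M => I.relB x i M (j + 1))
    (F := fun M => I.relB x i M j +
      I.increment i M j * (x j M i * g (level i (I.increment i) M j)))
    (F' := fun M => I.increment i M j * (x j M i / 2 * jump i (I.increment i) M j))]
  · congr 1
    funext M
    rw [add_div, B_div_budget, increaseB_div_budget]
    ring
  · intro M M' h
    have h1 := hd.adapted j h
    have h2 := hd.dependsOn_jump j h
    have h3 := hx.adapted j h
    dsimp only at h1 h2
    simp only [h1, h2, h3]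
  · intro M
    rw [relB, sumBefore_succ, increaseB_realized_div_budget, relB]
    ring

/-- The total of the positive parts of the scores before the arrival of `j`, weighted by the final
fractions; its expectation is the dual variable of `j`. -/
def payment (I : BudgetInstance L n) (x : Fin n → Assignment L n → L → ℝ) (j : Fin n)
    (M : Assignment L n) : ℝ :=
  ∑ i, I.budget i * (I.increment i M j * x j M i * max 0 (1 - I.relB x i M j))

theorem payment_nonneg (hI : ∀ i j, I.weight i j ≤ δ * I.budget i) (hx : IsStrategy x)
    (j : Fin n) (M : Assignment L n) : 0 ≤ I.payment x j M :=
  Finset.sum_nonneg fun i _ => by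
    have := (isSmallIncrement hI i).nonneg M j
    have := hx.nonneg j M i
    have := (I.budget_pos i).le
    have := le_max_left 0 (1 - I.relB x i M j)
    positivity

theorem IsRun.isStrategy (hx : I.IsRun x) : IsStrategy x :=
  ⟨hx.isAdapted, hx.fraction_nonneg, hx.sum_fraction_le_one⟩

theorem IsRun.score_le_payment (hI : ∀ i j, I.weight i j ≤ δ * I.budget i) (hx : I.IsRun x)
    (j : Fin n) (M : Assignment L n) (k : L) : I.score x M j (x j M) k ≤ I.payment x j M := by
  by_cases hM : ∃ i, I.Y M j i < 1
  · refine (hx.score_le_sum hM k).trans (Finset.sum_le_sum fun i _ => ?_)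
    rw [B_div_budget, ← budget_mul_increment]
    have h1 : 0 ≤ I.budget i * (I.increment i M j * x j M i) :=
      mul_nonneg (I.budget_pos i).le
        (mul_nonneg ((isSmallIncrement hI i).nonneg M j) (hx.fraction_nonneg j M i))
    have h2 := mul_le_mul_of_nonneg_left (le_max_right 0 (1 - I.relB x i M j)) h1
    linarith
  -- When `j` is skipped all budgets are exhausted, so every gain and every score is zero.
  · push Not at hM
    have h1 := hM k
    rw [Y_eq_level] at h1
    have h2 := budget_mul_level_le (I := I) M j k
    have h3 := mul_le_mul_of_nonneg_left h1 (I.budget_pos k).le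
    have h4 : I.gain M j k = 0 := le_antisymm (by linarith) (I.gain_nonneg M j k)
    rw [score, h4, zero_mul]
    exact payment_nonneg hI hx.isStrategy j M

/-- The dual constraint of the pair `(k, j)` holds in expectation, up to a small error. -/
theorem IsRun.dual_feasible {θ : ℝ} (hθ : 0 < θ) (hθ1 : θ ≤ 1 / 2)
    (hI : ∀ i j, I.weight i j ≤ θ ^ 2 * I.budget i) (hx : I.IsRun x) (k : L) (j : Fin n) :
    I.weight k j * (1 - expectedReward x (fun M => I.relB x k M n) - 5 * θ) ≤
      expectedReward x (I.payment x j) := by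
  have hs := hx.isStrategy
  have hd := isSmallIncrement hI k
  have hsq : θ ^ 2 ≤ θ / 2 := by nlinarith
  have hw := I.weight_nonneg k j
  have hpt : ∀ M, I.weight k j *
      (1 - (I.B x M j k + I.increaseB M j k 1 (x j M k)) / I.budget k) ≤
        I.payment x j M + I.weight k j * (3 * θ ^ 2 + |noise x k (I.increment k) M j|) := by
    intro M
    have h1 := hx.score_le_payment hI j M k
    have h2 := sq_nonneg θ
    have h3 := abs_nonneg (noise x k (I.increment k) M j)
    have h4 : I.gain M j k ≤ I.weight k j := min_le_left _ _
    rw [score] at h1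
    -- With full gain the score bound suffices. With truncated gain the level is at least `1 - θ ^
    -- 2`, so the relative slack is at most `3 * θ ^ 2` plus noise: one `θ ^ 2` from `one_sub_le`
    -- and two from `g 1 - g (1 - θ ^ 2)`.
    rcases h4.eq_or_lt with h5 | h5
    · rw [h5] at h1
      have : 0 ≤ I.weight k j * (3 * θ ^ 2 + |noise x k (I.increment k) M j|) := by positivity
      linarith
    · have h6 := one_sub_le_level_of_gain_lt hI h2 h5
      have h7 := hd.one_sub_le (by linarith) j.2.le (mul_compensator_le_relB hI hs k M j)
      have h8 : g 1 - g (1 - θ ^ 2) ≤ 2 * θ ^ 2 := by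
        have h := sub_le_mul_g (1 - θ ^ 2) (θ ^ 2)
        rw [sub_add_cancel] at h
        have := mul_le_mul_of_nonneg_left g_one_le_two h2
        linarith
      have h9 := g_mono h6
      have h10 : 0 ≤ I.increaseB M j k 1 (x j M k) / I.budget k := by
        rw [increaseB_div_budget]
        have := hd.nonneg M j
        have := hd.jump_nonneg M j
        have := hs.nonneg j M k
        have := (g_pos (level k (I.increment k) M j)).le
        positivity
      have h11 : 1 - (I.B x M j k + I.increaseB M j k 1 (x j M k)) / I.budget k ≤
          3 * θ ^ 2 + |noise x k (I.increment k) M j| := by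
        rw [add_div, B_div_budget]
        have := g_one_eq
        linarith
      have h12 := mul_le_mul_of_nonneg_left h11 (sub_nonneg.2 h4)
      have h13 : 0 ≤ I.gain M j k * (3 * θ ^ 2 + |noise x k (I.increment k) M j|) :=
        mul_nonneg (I.gain_nonneg M j k) (by positivity)
      linarith
  have h := hs.mono hpt
  rw [expectedReward_mul_left, expectedReward_sub, expectedReward_const hs.adapted,
    expectedReward_relB_succ hI hs, expectedReward_add, expectedReward_mul_left,
    expectedReward_add, expectedReward_const hs.adapted] at h
  have hN := hd.expectedReward_abs_noise_le hθ hs j.2.le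
  have hB : expectedReward x (fun M => I.relB x k M (j + 1)) ≤
      expectedReward x (fun M => I.relB x k M n) :=
    hs.mono fun M => sumBefore_mono (increaseB_realized_nonneg hI hs k M) j.2
  have h1 := mul_le_mul_of_nonneg_left hN hw
  have h2 := mul_le_mul_of_nonneg_left hB hw
  have h3 := mul_le_mul_of_nonneg_left hsq hw
  have h4 := mul_nonneg hw hθ.le
  linarith

/-- The competitive ratio for additive budgets with small weights. -/
theorem IsRun.competitive {θ : ℝ} (hθ : 0 < θ) (hθ1 : θ ≤ 1 / 5)
    (hI : ∀ i j, I.weight i j ≤ θ ^ 2 * I.budget i) (hx : I.IsRun x) (M : Assignment L n) :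
    (1 - 5 * θ) * ∑ i, min (I.budget i) (∑ j, I.weight i j * X M i j) ≤
      (g 1 + 10 * θ) * expectedReward x
        (fun M => ∑ i, min (I.budget i) (∑ j, I.weight i j * X M i j)) := by
  have hs := hx.isStrategy
  set β : L → ℝ := fun k => expectedReward x (fun M => I.relB x k M n) with hβ
  set A : Fin n → ℝ := fun j => expectedReward x (I.payment x j) with hA
  have hA0 : ∀ j, 0 ≤ A j := fun j => by
    rw [← expectedReward_const hs.adapted 0]
    exact hs.mono fun M => payment_nonneg hI hs j M
  have hβ0 : ∀ k, 0 ≤ β k := fun k => by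
    rw [← expectedReward_const hs.adapted 0]
    exact hs.mono fun M => by
      unfold relB sumBefore
      exact Finset.sum_nonneg fun j _ => increaseB_realized_nonneg hI hs k M j
  have hvertex : ∀ k, (1 - 5 * θ) * min (I.budget k) (∑ j, I.weight k j * X M k j) ≤
      I.budget k * β k + ∑ j, X M k j * A j := by
    intro k
    set S := ∑ j, I.weight k j * X M k j
    have hS : 0 ≤ S := Finset.sum_nonneg fun j _ =>
      mul_nonneg (I.weight_nonneg k j) (X_nonneg M k j)
    have hm0 : 0 ≤ min (I.budget k) S := le_min (I.budget_pos k).le hS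
    have hP : 0 ≤ ∑ j, X M k j * A j := Finset.sum_nonneg fun j _ =>
      mul_nonneg (X_nonneg M k j) (hA0 j)
    have h1 : min (I.budget k) S * β k ≤ I.budget k * β k :=
      mul_le_mul_of_nonneg_right (min_le_left _ _) (hβ0 k)
    -- If the slack is negative the claim is trivial; otherwise the dual constraints are added up
    -- over the vertices that `M` assigns to `k`.
    have h2 : min (I.budget k) S * (1 - β k - 5 * θ) ≤ ∑ j, X M k j * A j := by
      rcases le_total (1 - β k - 5 * θ) 0 with h | h
      · exact (mul_nonpos_of_nonneg_of_nonpos hm0 h).trans hP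
      · refine (mul_le_mul_of_nonneg_right (min_le_right _ _) h).trans ?_
        rw [Finset.sum_mul]
        refine Finset.sum_le_sum fun j _ => ?_
        have := mul_le_mul_of_nonneg_left
          (hx.dual_feasible hθ (by linarith) hI k j) (X_nonneg M k j)
        linarith
    linarith
  have hone : ∀ j, ∑ k, X M k j ≤ 1 := fun j => by
    cases h : M j <;> simp [X, h]
  have hdual : ∑ k, I.budget k * β k + ∑ j, A j ≤
      (g 1 + 10 * θ) * expectedReward x
        (fun M => ∑ i, min (I.budget i) (∑ j, I.weight i j * X M i j)) := by
    have hAsum : ∑ j, A j = ∑ k, I.budget k * expectedReward x (fun M =>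
        ∑ j : Fin n, I.increment k M j * x j M k * max 0 (1 - I.relB x k M j)) := by
      simp only [← expectedReward_mul_left, hA, ← expectedReward_sum]
      congr 1
      funext M
      simp only [payment, Finset.mul_sum]
      exact Finset.sum_comm
    rw [hAsum, ← Finset.sum_add_distrib, expectedReward_sum, Finset.mul_sum]
    refine Finset.sum_le_sum fun k _ => ?_
    have h := (isSmallIncrement hI k).expectedReward_dual_le hθ (by linarith) hs
      (fun M t _ => mul_compensator_le_relB hI hs k M t)
      (fun M => relB_le_mul_compensator hI hs k M n)
    have h' := mul_le_mul_of_nonneg_left h (I.budget_pos k).le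
    have e : expectedReward x (fun M => min (I.budget k) (∑ j, I.weight k j * X M k j)) =
        I.budget k * expectedReward x (fun M => level k (I.increment k) M n) := by
      rw [← expectedReward_mul_left]
      congr 1
      funext M
      rw [budget_mul_level M k n le_rfl, sumBefore_self]
    rw [e]
    linarith
  calc _ = ∑ k, (1 - 5 * θ) * min (I.budget k) (∑ j, I.weight k j * X M k j) :=
        Finset.mul_sum _ _ _
    _ ≤ ∑ k, (I.budget k * β k + ∑ j, X M k j * A j) :=
        Finset.sum_le_sum fun k _ => hvertex k
    _ = ∑ k, I.budget k * β k + ∑ j, (∑ k, X M k j) * A j := by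
        rw [Finset.sum_add_distrib, Finset.sum_comm]
        simp only [Finset.sum_mul]
    _ ≤ ∑ k, I.budget k * β k + ∑ j, A j := by
        gcongr with j
        exact mul_le_of_le_one_left (hA0 j) (hone j)
    _ ≤ _ := hdual

end

end BudgetInstance

/-! ### From additive budgets to stochastic rewards -/

theorem StochasticInstance.reward_eq {L : Type*} [Fintype L] [DecidableEq L] {n : ℕ}
    (I : StochasticInstance L n) (M : Assignment L n) :
    I.reward M = ∑ i, min (I.toBudget.budget i) (∑ j, I.toBudget.weight i j * X M i j) := by
  refine Finset.sum_congr rfl fun i _ => ?_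
  change _ = min (I.weight i) (∑ j, I.weight i * I.prob i j * X M i j)
  rw [mul_min_of_nonneg _ _ (I.weight_pos i).le, mul_one, Finset.sum_filter, Finset.mul_sum]
  congr 1
  refine Finset.sum_congr rfl fun j _ => ?_
  simp only [X]
  split_ifs <;> simp

theorem StochasticInstance.reward_nonneg {L : Type*} [Fintype L] [DecidableEq L] {n : ℕ}
    (I : StochasticInstance L n) (M : Assignment L n) : 0 ≤ I.reward M :=
  Finset.sum_nonneg fun i _ => mul_nonneg (I.weight_pos i).le
    (le_min zero_le_one (Finset.sum_nonneg fun j _ => I.prob_nonneg i j))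

end OnlineMatching

end

theorem mainTheorem3 (ε : ℝ) (hε : 0 < ε) :
    ∃ δ : ℝ, 0 < δ ∧
      ∀ (L : Type*) [Fintype L] [DecidableEq L] (n : ℕ)
        (I : OnlineMatching.StochasticInstance L n),
        (∀ i j, I.prob i j ≤ δ) →
          (∃ x : Fin n → OnlineMatching.Assignment L n → L → ℝ, I.toBudget.IsRun x) ∧
          ∀ x : Fin n → OnlineMatching.Assignment L n → L → ℝ, I.toBudget.IsRun x →
            (1 - 1 / Real.exp 1 - ε) * I.opt ≤ OnlineMatching.expectedReward x I.reward := by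
  set θ : ℝ := min (1 / 5) (ε / 15) with hθdef
  have hθ : 0 < θ := lt_min (by norm_num) (by positivity)
  have hθ5 : θ ≤ 1 / 5 := min_le_left _ _
  have hθε : θ ≤ ε / 15 := min_le_right _ _
  refine ⟨θ ^ 2, by positivity, fun L _ _ n I hp => ⟨I.toBudget.exists_isRun, fun x hx => ?_⟩⟩
  obtain ⟨M, -, hM⟩ := Finset.exists_mem_eq_sup' (Finset.univ_nonempty
    (α := OnlineMatching.Assignment L n)) I.reward
  have hopt : I.opt = I.reward M := hM
  have hI : ∀ i j, I.toBudget.weight i j ≤ θ ^ 2 * I.toBudget.budget i := fun i j => by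
    have := mul_le_mul_of_nonneg_left (hp i j) (I.weight_pos i).le
    exact this.trans_eq (mul_comm _ _)
  have hc := hx.competitive hθ hθ5 hI M
  simp only [← I.reward_eq] at hc
  change _ ≤ _ * OnlineMatching.expectedReward x I.reward at hc
  have hALG : 0 ≤ OnlineMatching.expectedReward x I.reward := by
    rw [← OnlineMatching.expectedReward_const hx.isAdapted 0]
    exact hx.isStrategy.mono fun M => I.reward_nonneg M
  rw [hopt]
  have hR := I.reward_nonneg M
  have hcpos := OnlineMatching.one_sub_inv_exp_pos
  have hg : OnlineMatching.g 1 * (1 - 1 / Real.exp 1) = 1 := by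
    unfold OnlineMatching.g
    rw [sub_self, Real.exp_zero, div_mul_cancel₀ _ hcpos.ne']
  have hg0 := OnlineMatching.g_pos 1
  have hc1 : 1 - 1 / Real.exp 1 ≤ 1 := by
    have : 0 ≤ 1 / Real.exp 1 := by positivity
    linarith
  set c := 1 - 1 / Real.exp 1
  have hg1 : 1 ≤ OnlineMatching.g 1 := by
    have := mul_le_mul_of_nonneg_left hc1 hg0.le
    linarith
  -- Since `c * g 1 = 1`, `c ≤ 1` and `1 ≤ g 1`, the left side is at most `1 + 10 * θ - ε`; hence
  -- the choice `θ ≤ ε / 15`.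
  have hkey : (c - ε) * (OnlineMatching.g 1 + 10 * θ) ≤ 1 - 5 * θ := by
    have h1 := mul_le_mul_of_nonneg_left hg1 hε.le
    have h2 := mul_le_mul_of_nonneg_left hc1 hθ.le
    have h3 := mul_nonneg hε.le hθ.le
    linarith
  refine le_of_mul_le_mul_left ?_ (show 0 < OnlineMatching.g 1 + 10 * θ by positivity)
  calc (OnlineMatching.g 1 + 10 * θ) * ((c - ε) * I.reward M)
      = (c - ε) * (OnlineMatching.g 1 + 10 * θ) * I.reward M := by ring
    _ ≤ (1 - 5 * θ) * I.reward M := mul_le_mul_of_nonneg_right hkey hR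
    _ ≤ _ := hc
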